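/- **Generalization of Campbell's theorem.** For a measurable space $\Omega$ let $\mathcal M(\Omega)$ be the set of finite measures and $\mathcal S(\Omega)$ the space of finite signed measures with the total variation norm, so that $\|\mu\|=\mu(\Omega)$ for $\mu\in\mathcal M(\Omega)$. Let $\mathcal S^{1/2}(\Omega)$ be the Banach space of square roots of signed measures, i.e. the direct limit, over $\mu\in\mathcal M(\Omega)$ directed by absolute continuity, of the spaces $\mathcal S^{1/2}(\Omega;\mu)=\{\phi\,\mu^{1/2}:\phi\in L^2(\mu)\}$ with norm $\|\phi\mu^{1/2}\|=\|\phi\|_{L^2(\mu)}$ and identifications $\phi\,\mu^{1/2}=\phi\,(d\mu/d\nu)^{1/2}\,\nu^{1/2}$ for $\mu\ll\nu$. Put $\mathcal M^{1/2}(\Omega)=\{\mu^{1/2}:\mu\in\mathcal M(\Omega)\}$, with tangent cones $T_{\mu^{1/2}}\mathcal M^{1/2}(\Omega)=\mathcal S^{1/2}(\Omega;\mu)$. A vector field on $\mathcal M^{1/2}(\Omega)$ is a continuous map $X:\mathcal M^{1/2}(\Omega)\to\mathcal S^{1/2}(\Omega)$ with $X_{\mu^{1/2}}\in T_{\mu^{1/2}}\mathcal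 M^{1/2}(\Omega)$; a $2$-tensor on $\mathcal M^{1/2}(\Omega)$ is a collection of bilinear forms $\Psi_{\mu^{1/2}}$ on the tangent cones such that $\mu^{1/2}\mapsto\Psi_{\mu^{1/2}}(X_{\mu^{1/2}},Y_{\mu^{1/2}})$ is continuous for all vector fields $X,Y$. At $\mu^{1/2}$ set $$\mathfrak g_F(\phi\mu^{1/2},\psi\mu^{1/2})=4\int_\Omega\phi\psi\,d\mu,\qquad \tau^1(\phi\mu^{1/2})=2\int_\Omega\phi\,d\mu .$$ A Markov kernel $K:\Omega\to\mathcal P(\Omega')$ is congruent if there is a measurable $\kappa:\Omega'\to\Omega$ with $\kappa_*K(\omega)=\delta_\omega$ for all $\omega$. It acts on $T_{\mu^{1/2}}\mathcal M^{1/2}(\Omega)$ by the formal derivative $$dK(\phi\mu^{1/2})=\frac{d\{K_*(\phi\mu)\}}{d\{K_*\mu\}}\,(K_*\mu)^{1/2},\qquad K_*\sigma(A')=\int_\Omega K(\omega;A')\,d\sigma(\omega).$$ A collection $(\Theta_\Omega)$ of $2$-tensors on $\mathcal M^{1/2}(\Omega)$, one for each measurable space $\Omega$, is a congruent family if $(\Theta_{\Omega'})_{(K_*\mu)^{1/2}}(dK(V_1),dK(V_2))=(\Theta_\Omega)_{\mu^{1/2}}(V_1,V_2)$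 for all congruent Markov kernels $K:\Omega\to\mathcal P(\Omega')$, all $\mu\in\mathcal M(\Omega)$ and all $V_1,V_2\in T_{\mu^{1/2}}\mathcal M^{1/2}(\Omega)$. **Statement.** Let $(\Theta_\Omega)$ be a congruent family of $2$-tensors on $\mathcal M^{1/2}(\Omega)$. Then there are continuous functions $a,b:(0,\infty)\to\mathbb R$ such that for all $\Omega$, all $\mu\in\mathcal M(\Omega)$ and all $V_1,V_2\in T_{\mu^{1/2}}\mathcal M^{1/2}(\Omega)$ $$(\Theta_\Omega)_{\mu^{1/2}}(V_1,V_2)=a(\|\mu\|)\,\mathfrak g_F(V_1,V_2)+b(\|\mu\|)\,\tau^1(V_1)\,\tau^1(V_2).$$ Moreover, with the same $a,b$: let $M$ be a (finite- or infinite-dimensional, boundaryless) $C^1$ manifold modelled on a real normed space and $\mathbf p:M\to\mathcal M(\Omega)$ a $2$-integrable parametrized measure model, i.e. $\mathbf p$ is Fréchet differentiable as a map into $\mathcal S(\Omega)$ and $\mathbf p^{1/2}:M\to\mathcal S^{1/2}(\Omega)$ is continuously Fréchet differentiable. Let $\partial_V\log\mathbf p(\xi)=d\{d_\xi\mathbf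 p(V)\}/d\{\mathbf p(\xi)\}$ be the logarithmic derivative. Then for all $\xi\in M$ and $V_1,V_2\in T_\xi M$ the vectors $d_\xi\mathbf p^{1/2}(V_i)$ lie in $T_{\mathbf p(\xi)^{1/2}}\mathcal M^{1/2}(\Omega)$, the function $\partial_{V_1}\log\mathbf p(\xi)\,\partial_{V_2}\log\mathbf p(\xi)$ is $\mathbf p(\xi)$-integrable, $\|\mathbf p\|$ is differentiable at $\xi$, and $$(\Theta_\Omega)_{\mathbf p(\xi)^{1/2}}\big(d_\xi\mathbf p^{1/2}(V_1),d_\xi\mathbf p^{1/2}(V_2)\big)=a(\|\mathbf p(\xi)\|)\int_\Omega\partial_{V_1}\log\mathbf p(\xi)\,\partial_{V_2}\log\mathbf p(\xi)\,d\mathbf p(\xi)+b(\|\mathbf p(\xi)\|)\,\big(\partial_{V_1}\|\mathbf p(\xi)\|\big)\big(\partial_{V_2}\|\mathbf p(\xi)\|\big).$$ (At the zero measure all tensors involved vanish, and the right-hand sides are read as $0$.) -/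

import Mathlib

open MeasureTheory ProbabilityTheory Set
open scoped Manifold ENNReal

universe u v w

/-! ### Signed measures with the total variation norm -/

namespace MeasureTheory.SignedMeasure

variable {Ω : Type u} [MeasurableSpace Ω]

/-- Total variation norm of a signed measure. -/
noncomputable instance instNormTV : Norm (SignedMeasure Ω) where
  norm σ := (σ.totalVariation univ).toReal

theorem norm_def (σ : SignedMeasure Ω) : ‖σ‖ = (σ.totalVariation univ).toReal := rfl

theorem totalVariation_univ_ne_top (σ : SignedMeasure Ω) : σ.totalVariation univ ≠ ∞ := by
  simp [totalVariation]

theorem normCore : NormedSpace.Core ℝ (SignedMeasure Ω) where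
  norm_nonneg σ := ENNReal.toReal_nonneg
  norm_smul c σ := by
    simp [norm_def, totalVariation_eq_variation, VectorMeasure.variation_smul]
  norm_triangle σ τ := by
    rw [norm_def, norm_def, norm_def, ← ENNReal.toReal_add (totalVariation_univ_ne_top σ)
      (totalVariation_univ_ne_top τ)]
    refine ENNReal.toReal_mono (ENNReal.add_ne_top.2 ⟨totalVariation_univ_ne_top σ,
      totalVariation_univ_ne_top τ⟩) ?_
    simp only [totalVariation_eq_variation]
    exact VectorMeasure.variation_add_le univ
  norm_eq_zero_iff σ := by
    rw [norm_def, ENNReal.toReal_eq_zero_iff]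
    simp [totalVariation_univ_ne_top σ]
    rw [totalVariation_eq_variation, VectorMeasure.variation_eq_zero]

noncomputable instance instNormedAddCommGroupTV : NormedAddCommGroup (SignedMeasure Ω) :=
  NormedAddCommGroup.ofCore normCore

noncomputable instance instNormedSpaceTV : NormedSpace ℝ (SignedMeasure Ω) :=
  NormedSpace.ofCore normCore

end MeasureTheory.SignedMeasure

namespace InfoGeom

/-! ### The space `𝒮^{1/2}(Ω)` of square roots of signed measures -/

section HalfDensity

variable {Ω : Type u} [MeasurableSpace Ω]

/-- Finite measures on `Ω`, preordered by absolute continuity. -/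
structure DomMeasure (Ω : Type u) [MeasurableSpace Ω] where
  meas : FiniteMeasure Ω

instance : Preorder (DomMeasure Ω) where
  le μ ν := (μ.meas : Measure Ω) ≪ (ν.meas : Measure Ω)
  le_refl _ := Measure.AbsolutelyContinuous.rfl
  le_trans _ _ _ h h' := h.trans h'

instance : Nonempty (DomMeasure Ω) := ⟨⟨0⟩⟩

instance : IsDirectedOrder (DomMeasure Ω) where
  directed μ ν := by
    refine ⟨⟨μ.meas + ν.meas⟩, ?_, ?_⟩
    · change (μ.meas : Measure Ω) ≪ ((μ.meas + ν.meas : FiniteMeasure Ω) : Measure Ω)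
      rw [FiniteMeasure.toMeasure_add]
      exact (Measure.AbsolutelyContinuous.rfl).add_right _
    · change (ν.meas : Measure Ω) ≪ ((μ.meas + ν.meas : FiniteMeasure Ω) : Measure Ω)
      rw [FiniteMeasure.toMeasure_add, add_comm]
      exact (Measure.AbsolutelyContinuous.rfl).add_right _

/-- The function `(dμ/dν)^{1/2}`. -/
noncomputable def rootDeriv (μ ν : Measure Ω) (ω : Ω) : ℝ := √(μ.rnDeriv ν ω).toReal

theorem measurable_rootDeriv (μ ν : Measure Ω) : Measurable (rootDeriv μ ν) :=
  (Measure.measurable_rnDeriv μ ν).ennreal_toReal.sqrt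

theorem ae_imp_of_ac {μ ν : Measure Ω} [IsFiniteMeasure μ] [IsFiniteMeasure ν] (h : μ ≪ ν)
    {P : Ω → Prop} (hP : ∀ᵐ ω ∂μ, P ω) : ∀ᵐ ω ∂ν, μ.rnDeriv ν ω ≠ 0 → P ω := by
  rw [← Measure.withDensity_rnDeriv_eq μ ν h] at hP
  exact (ae_withDensity_iff (Measure.measurable_rnDeriv μ ν)).1 hP

theorem rootDeriv_eq_zero {μ ν : Measure Ω} {ω : Ω} (h : μ.rnDeriv ν ω = 0) :
    rootDeriv μ ν ω = 0 := by simp [rootDeriv, h]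

theorem ae_mul_rootDeriv_congr {μ ν : Measure Ω} [IsFiniteMeasure μ] [IsFiniteMeasure ν]
    (h : μ ≪ ν) {f g : Ω → ℝ} (hfg : f =ᵐ[μ] g) :
    (fun ω => f ω * rootDeriv μ ν ω) =ᵐ[ν] fun ω => g ω * rootDeriv μ ν ω := by
  filter_upwards [ae_imp_of_ac h hfg] with ω hω
  by_cases h0 : μ.rnDeriv ν ω = 0
  · simp [rootDeriv_eq_zero h0]
  · rw [hω h0]

theorem eLpNorm_mul_rootDeriv {μ ν : Measure Ω} [IsFiniteMeasure μ] [IsFiniteMeasure ν]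
    (h : μ ≪ ν) {f : Ω → ℝ} (hf : StronglyMeasurable f) :
    eLpNorm (fun ω => f ω * rootDeriv μ ν ω) 2 ν = eLpNorm f 2 μ := by
  rw [eLpNorm_eq_lintegral_rpow_enorm_toReal two_ne_zero ENNReal.ofNat_ne_top,
    eLpNorm_eq_lintegral_rpow_enorm_toReal two_ne_zero ENNReal.ofNat_ne_top,
    ← lintegral_rnDeriv_mul h (by fun_prop)]
  congr 1
  refine lintegral_congr_ae ?_
  filter_upwards [Measure.rnDeriv_ne_top μ ν] with ω hω
  have : ‖rootDeriv μ ν ω‖ₑ ^ (2 : ℝ) = μ.rnDeriv ν ω := by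
    rw [rootDeriv, Real.enorm_of_nonneg (Real.sqrt_nonneg _),
      ENNReal.ofReal_rpow_of_nonneg (Real.sqrt_nonneg _) (by norm_num)]
    rw [Real.rpow_two, Real.sq_sqrt ENNReal.toReal_nonneg, ENNReal.ofReal_toReal hω]
  simp only [ENNReal.toReal_ofNat]
  rw [enorm_mul, ENNReal.mul_rpow_of_nonneg _ _ (by norm_num), this, mul_comm]

theorem memLp_mul_rootDeriv {μ ν : Measure Ω} [IsFiniteMeasure μ] [IsFiniteMeasure ν]
    (h : μ ≪ ν) (φ : Lp ℝ 2 μ) : MemLp (fun ω => φ ω * rootDeriv μ ν ω) 2 ν := by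
  refine ⟨((Lp.stronglyMeasurable φ).measurable.mul
    (measurable_rootDeriv μ ν)).aestronglyMeasurable, ?_⟩
  rw [eLpNorm_mul_rootDeriv h (Lp.stronglyMeasurable φ)]
  exact Lp.eLpNorm_lt_top φ

/-- For `μ ≪ ν`, the isometric inclusion `L²(μ) → L²(ν)`, `φ ↦ φ (dμ/dν)^{1/2}`, which expresses
`φ μ^{1/2} = φ (dμ/dν)^{1/2} ν^{1/2}`. -/
noncomputable def changeBase (μ ν : DomMeasure Ω) (h : μ ≤ ν) :
    Lp ℝ 2 (μ.meas : Measure Ω) →ₗᵢ[ℝ] Lp ℝ 2 (ν.meas : Measure Ω) where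
  toFun φ := (memLp_mul_rootDeriv h φ).toLp _
  map_add' φ ψ := by
    rw [← MemLp.toLp_add (memLp_mul_rootDeriv h φ) (memLp_mul_rootDeriv h ψ), MemLp.toLp_eq_toLp_iff]
    refine (ae_mul_rootDeriv_congr h (Lp.coeFn_add φ ψ)).trans (.of_forall fun ω => ?_)
    simp [add_mul]
  map_smul' c φ := by
    rw [RingHom.id_apply, ← MemLp.toLp_const_smul c (memLp_mul_rootDeriv h φ), MemLp.toLp_eq_toLp_iff]
    refine (ae_mul_rootDeriv_congr h (Lp.coeFn_smul c φ)).trans (.of_forall fun ω => ?_)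
    simp [mul_assoc]
  norm_map' φ := by
    change ‖(memLp_mul_rootDeriv h φ).toLp _‖ = ‖φ‖
    rw [Lp.norm_toLp, eLpNorm_mul_rootDeriv h (Lp.stronglyMeasurable φ), Lp.norm_def]

theorem coeFn_changeBase {μ ν : DomMeasure Ω} (h : μ ≤ ν) (φ : Lp ℝ 2 (μ.meas : Measure Ω)) :
    changeBase μ ν h φ =ᵐ[(ν.meas : Measure Ω)]
      fun ω => φ ω * rootDeriv (μ.meas : Measure Ω) (ν.meas : Measure Ω) ω :=
  MemLp.coeFn_toLp (memLp_mul_rootDeriv h φ)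

instance : DirectedSystem (fun μ : DomMeasure Ω => Lp ℝ 2 (μ.meas : Measure Ω))
    (fun μ ν h => changeBase μ ν h) where
  map_self μ φ := by
    apply Lp.ext
    refine (coeFn_changeBase le_rfl φ).trans ?_
    filter_upwards [Measure.rnDeriv_self (μ.meas : Measure Ω)] with ω hω
    simp [rootDeriv, hω]
  map_map κ ν μ hμν hνκ φ := by
    apply Lp.ext
    refine (coeFn_changeBase _ _).trans ?_
    refine (ae_mul_rootDeriv_congr hνκ (coeFn_changeBase hμν φ)).trans ?_
    refine .trans ?_ (coeFn_changeBase (hμν.trans hνκ) φ).symm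
    filter_upwards [Measure.rnDeriv_mul_rnDeriv (κ := (κ.meas : Measure Ω)) hμν] with ω hω
    rw [Pi.mul_apply] at hω
    rw [rootDeriv, rootDeriv, rootDeriv, ← hω, ENNReal.toReal_mul,
      Real.sqrt_mul ENNReal.toReal_nonneg, mul_assoc]

/-- The space `𝒮^{1/2}(Ω)`: the direct limit, over all finite measures `μ` directed by absolute
continuity, of the spaces `𝒮^{1/2}(Ω; μ) = {φ μ^{1/2} | φ ∈ L²(μ)}`. -/
def HalfDensity (Ω : Type u) [MeasurableSpace Ω] : Type u :=
  DirectLimit (fun μ : DomMeasure Ω => Lp ℝ 2 (μ.meas : Measure Ω)) changeBase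

namespace HalfDensity

noncomputable instance : AddCommGroup (HalfDensity Ω) :=
  inferInstanceAs (AddCommGroup
    (DirectLimit (fun μ : DomMeasure Ω => Lp ℝ 2 (μ.meas : Measure Ω)) changeBase))

noncomputable instance : Module ℝ (HalfDensity Ω) :=
  inferInstanceAs (Module ℝ
    (DirectLimit (fun μ : DomMeasure Ω => Lp ℝ 2 (μ.meas : Measure Ω)) changeBase))

/-- `φ ↦ φ μ^{1/2}` as a linear map `L²(μ) → 𝒮^{1/2}(Ω)`. -/
noncomputable def ofLinear (μ : FiniteMeasure Ω) : Lp ℝ 2 (μ : Measure Ω) →ₗ[ℝ] HalfDensity Ω :=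
  DirectLimit.Module.of ℝ (DomMeasure Ω) (fun μ : DomMeasure Ω => Lp ℝ 2 (μ.meas : Measure Ω))
    changeBase ⟨μ⟩

theorem exists_ofLinear (x : HalfDensity Ω) : ∃ μ φ, x = ofLinear μ φ := by
  obtain ⟨μ, φ, h⟩ := DirectLimit.exists_eq_mk changeBase x
  exact ⟨μ.meas, φ, h⟩

theorem exists_ofLinear₂ (x y : HalfDensity Ω) :
    ∃ μ φ ψ, x = ofLinear μ φ ∧ y = ofLinear μ ψ := by
  obtain ⟨μ, φ, ψ, h, h'⟩ := DirectLimit.exists_eq_mk₂ changeBase x y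
  exact ⟨μ.meas, φ, ψ, h, h'⟩

/-- The norm of `𝒮^{1/2}(Ω)`, given by `‖φ μ^{1/2}‖ = ‖φ‖_{L²(μ)}`. -/
noncomputable instance instNorm : Norm (HalfDensity Ω) where
  norm := DirectLimit.lift changeBase (fun _ φ => ‖φ‖)
    (fun μ ν h φ => ((changeBase μ ν h).norm_map φ).symm)

theorem norm_ofLinear (μ : FiniteMeasure Ω) (φ : Lp ℝ 2 (μ : Measure Ω)) :
    ‖ofLinear μ φ‖ = ‖φ‖ := rfl

theorem normCore : NormedSpace.Core ℝ (HalfDensity Ω) where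
  norm_nonneg x := by
    obtain ⟨μ, φ, rfl⟩ := exists_ofLinear x
    rw [norm_ofLinear]
    exact norm_nonneg φ
  norm_smul c x := by
    obtain ⟨μ, φ, rfl⟩ := exists_ofLinear x
    rw [← map_smul, norm_ofLinear, norm_ofLinear, norm_smul]
  norm_triangle x y := by
    obtain ⟨μ, φ, ψ, rfl, rfl⟩ := exists_ofLinear₂ x y
    rw [← map_add]
    simp only [norm_ofLinear]
    exact norm_add_le φ ψ
  norm_eq_zero_iff x := by
    obtain ⟨μ, φ, rfl⟩ := exists_ofLinear x
    rw [norm_ofLinear, norm_eq_zero]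
    refine ⟨fun h => by rw [h, map_zero], fun h => ?_⟩
    rw [← norm_eq_zero, ← norm_ofLinear μ φ, h, ← map_zero (ofLinear μ), norm_ofLinear, norm_zero]

noncomputable instance : NormedAddCommGroup (HalfDensity Ω) := NormedAddCommGroup.ofCore normCore

noncomputable instance : NormedSpace ℝ (HalfDensity Ω) := NormedSpace.ofCore normCore

/-- `φ ↦ φ μ^{1/2}` as a linear isometry `L²(μ) → 𝒮^{1/2}(Ω)`. -/
noncomputable def of (μ : FiniteMeasure Ω) : Lp ℝ 2 (μ : Measure Ω) →ₗᵢ[ℝ] HalfDensity Ω where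
  toLinearMap := ofLinear μ
  norm_map' := norm_ofLinear μ

end HalfDensity

/-- The square root `μ^{1/2} = 1 · μ^{1/2}` of a finite measure. The set `ℳ^{1/2}(Ω)` consists of
these elements, and we label its points `μ^{1/2}` by the measures `μ`. -/
noncomputable def sqrtMeasure (μ : FiniteMeasure Ω) : HalfDensity Ω :=
  HalfDensity.of μ (Lp.const 2 (μ : Measure Ω) (1 : ℝ))

/-- Labelling the points of `ℳ^{1/2}(Ω)` by `μ` loses nothing. -/
theorem sqrtMeasure_injective : Function.Injective (sqrtMeasure (Ω := Ω)) := by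
  intro μ ν h
  have key : ∀ (μ κ : DomMeasure Ω) (hl : μ ≤ κ),
      changeBase μ κ hl (Lp.const 2 (μ.meas : Measure Ω) (1 : ℝ)) =ᵐ[(κ.meas : Measure Ω)]
        rootDeriv (μ.meas : Measure Ω) (κ.meas : Measure Ω) := by
    intro μ κ hl
    refine (coeFn_changeBase hl _).trans ?_
    refine (ae_mul_rootDeriv_congr hl (Lp.coeFn_const ..)).trans (.of_forall fun ω => ?_)
    simp
  obtain ⟨κ, h1, h2⟩ := exists_ge_ge (⟨μ⟩ : DomMeasure Ω) ⟨ν⟩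
  have e1 := DirectLimit.Module.of_f (R := ℝ) (f := changeBase) (hij := h1)
    (x := Lp.const 2 (μ : Measure Ω) (1 : ℝ))
  have e2 := DirectLimit.Module.of_f (R := ℝ) (f := changeBase) (hij := h2)
    (x := Lp.const 2 (ν : Measure Ω) (1 : ℝ))
  have e3 : HalfDensity.of κ.meas (changeBase _ κ h1 (Lp.const 2 (μ : Measure Ω) (1 : ℝ)))
      = HalfDensity.of κ.meas (changeBase _ κ h2 (Lp.const 2 (ν : Measure Ω) (1 : ℝ))) :=
    e1.trans (h.trans e2.symm)
  have e4 := (HalfDensity.of κ.meas).injective e3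
  have e5 : rootDeriv (μ : Measure Ω) (κ.meas : Measure Ω) =ᵐ[(κ.meas : Measure Ω)]
      rootDeriv (ν : Measure Ω) (κ.meas : Measure Ω) := by
    refine (key ⟨μ⟩ κ h1).symm.trans (.trans ?_ (key ⟨ν⟩ κ h2))
    rw [e4]
  have e6 : (μ : Measure Ω).rnDeriv (κ.meas : Measure Ω) =ᵐ[(κ.meas : Measure Ω)]
      (ν : Measure Ω).rnDeriv (κ.meas : Measure Ω) := by
    filter_upwards [e5, Measure.rnDeriv_ne_top (μ : Measure Ω) (κ.meas : Measure Ω),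
      Measure.rnDeriv_ne_top (ν : Measure Ω) (κ.meas : Measure Ω)] with ω h h3 h4
    rw [rootDeriv, rootDeriv, Real.sqrt_inj ENNReal.toReal_nonneg ENNReal.toReal_nonneg] at h
    exact (ENNReal.toReal_eq_toReal_iff' h3 h4).1 h
  apply Subtype.ext
  change (μ : Measure Ω) = (ν : Measure Ω)
  rw [← Measure.withDensity_rnDeriv_eq _ _ h1, ← Measure.withDensity_rnDeriv_eq _ _ h2]
  exact withDensity_congr_ae e6

end HalfDensity

/-! ### Vector fields and `2`-tensor fields on `ℳ^{1/2}(Ω)` -/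

section Tensor

variable {Ω : Type u} [MeasurableSpace Ω]

/-- The tangent cone `T_{μ^{1/2}} ℳ^{1/2}(Ω) = 𝒮^{1/2}(Ω; μ) = {φ μ^{1/2} | φ ∈ L²(μ)}`. -/
noncomputable def tangent (μ : FiniteMeasure Ω) : Submodule ℝ (HalfDensity Ω) :=
  LinearMap.range (HalfDensity.of μ).toLinearMap

/-- The isomorphism `L²(μ) ≃ 𝒮^{1/2}(Ω; μ)`, `φ ↦ φ μ^{1/2}`. -/
noncomputable def tangentEquiv (μ : FiniteMeasure Ω) : Lp ℝ 2 (μ : Measure Ω) ≃ₗ[ℝ] tangent μ :=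
  LinearEquiv.ofInjective (HalfDensity.of μ).toLinearMap (HalfDensity.of μ).injective

/-- The function `φ` of a tangent vector `φ μ^{1/2}`. -/
noncomputable def density {μ : FiniteMeasure Ω} (V : tangent μ) : Lp ℝ 2 (μ : Measure Ω) :=
  (tangentEquiv μ).symm V

/-- Continuity, in the topology of `𝒮^{1/2}(Ω)`, of a map defined on `ℳ^{1/2}(Ω)`, that is, of
`μ^{1/2} ↦ F μ`. -/
def ContinuousOnSqrt {Y : Type*} [TopologicalSpace Y] (F : FiniteMeasure Ω → Y) : Prop :=
  @Continuous _ _ (TopologicalSpace.induced sqrtMeasure inferInstance) _ F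

/-- A vector field on `ℳ^{1/2}(Ω)`: a continuous map `X : ℳ^{1/2}(Ω) → 𝒮^{1/2}(Ω)` such that
`X μ` is tangent at `μ^{1/2}`. -/
structure VectorField (Ω : Type u) [MeasurableSpace Ω] where
  toFun : ∀ μ : FiniteMeasure Ω, tangent μ
  continuous_toFun : ContinuousOnSqrt fun μ => (toFun μ : HalfDensity Ω)

/-- A covariant `2`-tensor field on `ℳ^{1/2}(Ω)`: bilinear forms on the tangent cones whose values
on continuous vector fields are continuous. -/
structure TwoTensorField (Ω : Type u) [MeasurableSpace Ω] where
  form : ∀ μ : FiniteMeasure Ω, LinearMap.BilinForm ℝ (tangent μ)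
  continuous_form : ∀ X Y : VectorField Ω,
    ContinuousOnSqrt fun μ => form μ (X.toFun μ) (Y.toFun μ)

/-- The Fisher metric, i.e. the canonical `2`-tensor `L²_Ω(ν₁, ν₂) = 2² ∫ d(ν₁ · ν₂)`, at
`μ^{1/2}`. -/
noncomputable def fisher (μ : FiniteMeasure Ω) (V W : tangent μ) : ℝ :=
  2 ^ 2 * ∫ ω, density V ω * density W ω ∂(μ : Measure Ω)

/-- The canonical `1`-tensor `τ¹_{Ω;1/2}(ν) = 2 ∫ d(ν · μ^{1/2})` at `μ^{1/2}`. -/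
noncomputable def tauOne (μ : FiniteMeasure Ω) (V : tangent μ) : ℝ :=
  2 * ∫ ω, density V ω ∂(μ : Measure Ω)

end Tensor

/-! ### Markov kernels and congruent families -/

section Markov

variable {Ω Ω' : Type u} [MeasurableSpace Ω] [MeasurableSpace Ω']

/-- The Markov kernel `K` is congruent: there is a statistic `κ : Ω' → Ω` with
`κ_* K(ω) = δ_ω` for all `ω`. -/
def IsCongruent (K : Kernel Ω Ω') : Prop :=
  ∃ κ : Ω' → Ω, Measurable κ ∧ ∀ ω, (K ω).map κ = Measure.dirac ω

/-- `K_* μ = ∫ K(ω; ·) dμ(ω)` for a finite measure `μ`. -/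
noncomputable def push (K : Kernel Ω Ω') [IsMarkovKernel K] (μ : FiniteMeasure Ω) :
    FiniteMeasure Ω' :=
  ⟨K ∘ₘ (μ : Measure Ω), inferInstance⟩

/-- The signed measure `K_*(φ μ)`, `A' ↦ ∫ K(ω; A') φ(ω) dμ(ω)`, has a density in `L²(K_* μ)`. -/
theorem exists_pushDensity (K : Kernel Ω Ω') [IsMarkovKernel K] (μ : FiniteMeasure Ω)
    (φ : Lp ℝ 2 (μ : Measure Ω)) :
    ∃ φ' : Lp ℝ 2 (push K μ : Measure Ω'), ∀ A' : Set Ω', MeasurableSet A' →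
      ∫ ω' in A', φ' ω' ∂(push K μ : Measure Ω') =
        ∫ ω, (K ω).real A' * φ ω ∂(μ : Measure Ω) := by
  set ρ : Measure (Ω × Ω') := (μ : Measure Ω) ⊗ₘ K with hρ
  have hfst : MeasurePreserving Prod.fst ρ (μ : Measure Ω) :=
    ⟨measurable_fst, Measure.fst_compProd (μ : Measure Ω) K⟩
  have hsnd : MeasurePreserving Prod.snd ρ (push K μ : Measure Ω') :=
    ⟨measurable_snd, Measure.snd_compProd (μ : Measure Ω) K⟩
  set f : Ω × Ω' → ℝ := fun x => φ x.1 with hf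
  have hfm : MemLp f 2 ρ := (Lp.memLp φ).comp_measurePreserving hfst
  have hfi : Integrable f ρ := hfm.integrable one_le_two
  have hmle : MeasurableSpace.comap (Prod.snd : Ω × Ω' → Ω') inferInstance ≤
      Prod.instMeasurableSpace := measurable_snd.comap_le
  obtain ⟨h, hmeas, hh⟩ :=
    (stronglyMeasurable_condExp (μ := ρ) (f := f) 
      (m := MeasurableSpace.comap (Prod.snd : Ω × Ω' → Ω') inferInstance)).measurable.exists_eq_measurable_comp
  have hhm : MemLp h 2 (push K μ : Measure Ω') := by
    have h1 : MemLp (h ∘ Prod.snd) 2 ρ := by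
      rw [← hh]
      exact hfm.condExp one_le_two
    rw [← hsnd.map_eq]
    exact (memLp_map_measure_iff hmeas.aestronglyMeasurable measurable_snd.aemeasurable).2 h1
  refine ⟨hhm.toLp h, fun A' hA' => ?_⟩
  have hS : MeasurableSet[MeasurableSpace.comap (Prod.snd : Ω × Ω' → Ω') inferInstance]
      (Prod.snd ⁻¹' A' : Set (Ω × Ω')) := ⟨A', hA', rfl⟩
  calc ∫ ω' in A', (hhm.toLp h) ω' ∂(push K μ : Measure Ω')
      = ∫ ω' in A', h ω' ∂(push K μ : Measure Ω') :=
        integral_congr_ae (ae_restrict_of_ae hhm.coeFn_toLp)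
    _ = ∫ x in Prod.snd ⁻¹' A', h x.2 ∂ρ := by
        rw [← hsnd.map_eq, setIntegral_map hA' hmeas.aestronglyMeasurable
          measurable_snd.aemeasurable]
    _ = ∫ x in Prod.snd ⁻¹' A', (condExp (MeasurableSpace.comap (Prod.snd : Ω × Ω' → Ω')
          inferInstance) ρ f) x ∂ρ := by
        rw [hh]; rfl
    _ = ∫ x in Prod.snd ⁻¹' A', f x ∂ρ :=
        setIntegral_condExp hmle hfi hS
    _ = ∫ x in univ ×ˢ A', f x ∂ρ := by rw [univ_prod]
    _ = ∫ ω, (K ω).real A' * φ ω ∂(μ : Measure Ω) := by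
        rw [Measure.setIntegral_compProd MeasurableSet.univ hA' hfi.integrableOn]
        simp [hf]

/-- The density `d{K_*(φ μ)} / d{K_* μ}`. -/
noncomputable def pushDensity (K : Kernel Ω Ω') [IsMarkovKernel K] (μ : FiniteMeasure Ω)
    (φ : Lp ℝ 2 (μ : Measure Ω)) : Lp ℝ 2 (push K μ : Measure Ω') :=
  (exists_pushDensity K μ φ).choose

theorem pushDensity_spec (K : Kernel Ω Ω') [IsMarkovKernel K] (μ : FiniteMeasure Ω)
    (φ : Lp ℝ 2 (μ : Measure Ω)) {A' : Set Ω'} (hA' : MeasurableSet A') :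
    ∫ ω' in A', pushDensity K μ φ ω' ∂(push K μ : Measure Ω') =
      ∫ ω, (K ω).real A' * φ ω ∂(μ : Measure Ω) :=
  (exists_pushDensity K μ φ).choose_spec A' hA'

theorem pushDensity_unique (K : Kernel Ω Ω') [IsMarkovKernel K] (μ : FiniteMeasure Ω)
    (φ : Lp ℝ 2 (μ : Measure Ω)) (ψ : Lp ℝ 2 (push K μ : Measure Ω'))
    (hψ : ∀ A' : Set Ω', MeasurableSet A' → ∫ ω' in A', ψ ω' ∂(push K μ : Measure Ω') =
      ∫ ω, (K ω).real A' * φ ω ∂(μ : Measure Ω)) :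
    pushDensity K μ φ = ψ := by
  apply Lp.ext
  refine Integrable.ae_eq_of_forall_setIntegral_eq _ _
    ((Lp.memLp (pushDensity K μ φ)).integrable one_le_two) ((Lp.memLp ψ).integrable one_le_two) ?_
  intro A' hA' _
  rw [pushDensity_spec K μ φ hA', hψ A' hA']

theorem integrable_real_mul (K : Kernel Ω Ω') [IsMarkovKernel K] (μ : FiniteMeasure Ω)
    (φ : Lp ℝ 2 (μ : Measure Ω)) {A' : Set Ω'} (hA' : MeasurableSet A') :
    Integrable (fun ω => (K ω).real A' * φ ω) (μ : Measure Ω) := by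
  refine ((Lp.memLp φ).integrable one_le_two).bdd_mul (c := 1)
    (K.measurable_coe hA').ennreal_toReal.aestronglyMeasurable (.of_forall fun ω => ?_)
  rw [Real.norm_of_nonneg measureReal_nonneg]
  exact measureReal_le_one

/-- `pushDensity` as a linear map. -/
noncomputable def pushDensityLinear (K : Kernel Ω Ω') [IsMarkovKernel K] (μ : FiniteMeasure Ω) :
    Lp ℝ 2 (μ : Measure Ω) →ₗ[ℝ] Lp ℝ 2 (push K μ : Measure Ω') where
  toFun := pushDensity K μ
  map_add' φ ψ := by
    refine pushDensity_unique K μ _ _ fun A' hA' => ?_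
    have h1 := ((Lp.memLp (pushDensity K μ φ)).integrable one_le_two).integrableOn (s := A')
    have h2 := ((Lp.memLp (pushDensity K μ ψ)).integrable one_le_two).integrableOn (s := A')
    rw [integral_congr_ae (ae_restrict_of_ae (Lp.coeFn_add _ _))]
    simp only [Pi.add_apply]
    rw [integral_add h1 h2, pushDensity_spec K μ φ hA', pushDensity_spec K μ ψ hA',
      ← integral_add (integrable_real_mul K μ φ hA') (integrable_real_mul K μ ψ hA')]
    refine integral_congr_ae ?_
    filter_upwards [Lp.coeFn_add φ ψ] with ω hω
    rw [hω, Pi.add_apply, mul_add]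
  map_smul' c φ := by
    refine pushDensity_unique K μ _ _ fun A' hA' => ?_
    rw [RingHom.id_apply, integral_congr_ae (ae_restrict_of_ae (Lp.coeFn_smul _ _))]
    simp only [Pi.smul_apply, smul_eq_mul]
    rw [integral_const_mul, pushDensity_spec K μ φ hA', ← integral_const_mul]
    refine integral_congr_ae ?_
    filter_upwards [Lp.coeFn_smul c φ] with ω hω
    rw [hω, Pi.smul_apply, smul_eq_mul, mul_left_comm]

/-- The formal derivative of `K_{1/2}` at `μ^{1/2}`,
`φ μ^{1/2} ↦ (d{K_*(φ μ)} / d{K_* μ}) (K_* μ)^{1/2}`. -/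
noncomputable def formalDeriv (K : Kernel Ω Ω') [IsMarkovKernel K] (μ : FiniteMeasure Ω) :
    tangent μ →ₗ[ℝ] tangent (push K μ) :=
  (tangentEquiv (push K μ)).toLinearMap ∘ₗ pushDensityLinear K μ ∘ₗ
    (tangentEquiv μ).symm.toLinearMap

/-- The pullback `(K_{1/2})^* Ψ` at `μ^{1/2}` of a `2`-tensor field on `ℳ^{1/2}(Ω')`. -/
noncomputable def pullbackForm (K : Kernel Ω Ω') [IsMarkovKernel K] (Ψ : TwoTensorField Ω')
    (μ : FiniteMeasure Ω) : LinearMap.BilinForm ℝ (tangent μ) :=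
  (Ψ.form (push K μ)).compl₁₂ (formalDeriv K μ) (formalDeriv K μ)

end Markov

/-- A collection of `2`-tensor fields on `ℳ^{1/2}(Ω)`, one for each measurable space `Ω`, is a
congruent family if it is invariant under pullback by every congruent Markov kernel. -/
def IsCongruentFamily (Θ : ∀ (Ω : Type u) [MeasurableSpace Ω], TwoTensorField Ω) : Prop :=
  ∀ (Ω Ω' : Type u) [MeasurableSpace Ω] [MeasurableSpace Ω'] (K : Kernel Ω Ω') [IsMarkovKernel K],
    IsCongruent K → ∀ μ : FiniteMeasure Ω, pullbackForm K (Θ Ω') μ = (Θ Ω).form μ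

/-! ### Parametrized measure models -/

section Model

variable {Ω : Type u} [MeasurableSpace Ω]
  {E : Type v} [NormedAddCommGroup E] [NormedSpace ℝ E]
  {M : Type w} [TopologicalSpace M] [ChartedSpace E M]

/-- `(M, Ω, p)` is a parametrized measure model: `p : M → ℳ(Ω) ⊆ 𝒮(Ω)` is Fréchet differentiable
for the total variation norm on `𝒮(Ω)`. -/
def IsParametrizedMeasureModel (p : M → FiniteMeasure Ω) : Prop :=
  MDifferentiable 𝓘(ℝ, E) 𝓘(ℝ, SignedMeasure Ω)
    fun ξ => (p ξ : Measure Ω).toSignedMeasure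

/-- The model is `2`-integrable: `p^{1/2} : M → 𝒮^{1/2}(Ω)` is moreover continuously Fréchet
differentiable. -/
def IsTwoIntegrable (p : M → FiniteMeasure Ω) : Prop :=
  IsParametrizedMeasureModel (E := E) p ∧
    ContMDiff 𝓘(ℝ, E) 𝓘(ℝ, HalfDensity Ω) 1 fun ξ => sqrtMeasure (p ξ)

/-- The differential `d_ξ p (V) ∈ 𝒮(Ω)`. -/
noncomputable def dModel (p : M → FiniteMeasure Ω) (ξ : M) (V : TangentSpace 𝓘(ℝ, E) ξ) :
    SignedMeasure Ω :=
  mfderiv 𝓘(ℝ, E) 𝓘(ℝ, SignedMeasure Ω) (fun ξ => (p ξ : Measure Ω).toSignedMeasure) ξ V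

/-- The logarithmic derivative `∂_V log p(ξ) = d{d_ξ p(V)} / d{p(ξ)}`. -/
noncomputable def logDeriv (p : M → FiniteMeasure Ω) (ξ : M) (V : TangentSpace 𝓘(ℝ, E) ξ) :
    Ω → ℝ :=
  (dModel p ξ V).rnDeriv (p ξ : Measure Ω)

/-- The differential `d_ξ p^{1/2} (V) ∈ 𝒮^{1/2}(Ω)`. -/
noncomputable def dSqrtModel (p : M → FiniteMeasure Ω) (ξ : M) (V : TangentSpace 𝓘(ℝ, E) ξ) :
    HalfDensity Ω :=
  mfderiv 𝓘(ℝ, E) 𝓘(ℝ, HalfDensity Ω) (fun ξ => sqrtMeasure (p ξ)) ξ V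

/-- The total mass `‖p(ξ)‖ = p(ξ)(Ω)`. -/
noncomputable def totalMass (p : M → FiniteMeasure Ω) (ξ : M) : ℝ := (p ξ).mass

/-- The directional derivative `∂_V ‖p(ξ)‖`. -/
noncomputable def dMass (p : M → FiniteMeasure Ω) (ξ : M) (V : TangentSpace 𝓘(ℝ, E) ξ) : ℝ :=
  mfderiv 𝓘(ℝ, E) 𝓘(ℝ, ℝ) (totalMass p) ξ V

end Model

end InfoGeom

/-! A congruent family sees only laws. If `f` takes finitely many values, both `μ` and its image
under `f` are carried by congruent kernels to the law of `(ω, f ω)`: from `μ` by the graph map, from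
the image by conditioning on the fibres of `f`. On vectors `x ∘ f`, `y ∘ f` the form is therefore
the form of a finite space (`IsCongruentFamily.form_comp`).

Choose `a`, `b` so that the formula holds for uniform measures on two points, and call the
difference of the two sides the defect; it has the same invariance. On a uniform measure over `J ×
Bool`, permutation invariance leaves one diagonal and one off-diagonal matrix entry, and projecting
to `Bool` kills both (`IsCongruentFamily.defect_uniform_prod`). Merging atoms gives commensurable
weights, continuity gives all weights, and finite partitions give all simple functions at every
measure.

Passing from simple functions to all of L² cannot be done by density at a fixed `μ`, because the
forms are not assumed bounded there; only continuity along vector fields is available. Hence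
`exists_vectorField`: any tangent vector at `μ` is the value of a continuous field that is simple at
every other point. The defect of two such fields vanishes at `t • μ` for `t ≠ 1`, hence also in the
limit `t → 1`.

For a model, derivatives are found from minima. A nonnegative pairing that vanishes at time 0 has
zero derivative, which puts the derivative `D` of the root in the tangent cone
(`exists_vec_of_hasDerivAt`). If `D` has density `φ`, a squared norm vanishing at time 0 shows that
the measure has derivative `2 φ μ` (`deriv_apply_eq`). So the logarithmic derivative is `2 φ`, and
the formula for the tensor becomes the formula for the model. -/

namespace InfoGeom

open Filter Topology
open scoped RealInnerProductSpace NNReal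

/-! ### Inner product on half-densities and calculus of tangent vectors. -/

section Basics

variable {Ω : Type u} [MeasurableSpace Ω]

theorem HalfDensity.exists_of (x : HalfDensity Ω) : ∃ μ φ, x = HalfDensity.of μ φ :=
  HalfDensity.exists_ofLinear x

/-- Any two half-densities lie in one common L² space, where the law is known. -/
theorem HalfDensity.parallelogram (x y : HalfDensity Ω) :
    ‖x + y‖ * ‖x + y‖ + ‖x - y‖ * ‖x - y‖ = 2 * (‖x‖ * ‖x‖ + ‖y‖ * ‖y‖) := by
  obtain ⟨μ, φ, ψ, rfl, rfl⟩ := HalfDensity.exists_ofLinear₂ x y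
  rw [← map_add, ← map_sub]
  simp only [HalfDensity.norm_ofLinear]
  have := parallelogram_law_with_norm ℝ φ ψ
  linarith

/-- The inner product `⟪φ μ^{1/2}, ψ μ^{1/2}⟫ = ∫ φ ψ dμ` of `𝒮^{1/2}(Ω)`. -/
noncomputable instance : InnerProductSpace ℝ (HalfDensity Ω) :=
  InnerProductSpace.ofNorm ℝ HalfDensity.parallelogram

theorem HalfDensity.inner_of (μ : FiniteMeasure Ω) (φ ψ : Lp ℝ 2 (μ : Measure Ω)) :
    ⟪HalfDensity.of μ φ, HalfDensity.of μ ψ⟫ = ∫ ω, φ ω * ψ ω ∂(μ : Measure Ω) := by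
  rw [LinearIsometry.inner_map_map, L2.inner_def]
  refine integral_congr_ae (.of_forall fun ω => ?_)
  simp [mul_comm]

open Classical in
/-- The tangent vector `φ μ^{1/2}` given by a square integrable function `φ`. -/
noncomputable def vec (μ : FiniteMeasure Ω) (φ : Ω → ℝ) : tangent μ :=
  if h : MemLp φ 2 (μ : Measure Ω) then tangentEquiv μ (h.toLp φ) else 0

variable {μ ν κ : FiniteMeasure Ω} {φ ψ : Ω → ℝ}

theorem vec_of_memLp (h : MemLp φ 2 (μ : Measure Ω)) : vec μ φ = tangentEquiv μ (h.toLp φ) :=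
  dif_pos h

theorem coe_vec (h : MemLp φ 2 (μ : Measure Ω)) :
    (vec μ φ : HalfDensity Ω) = HalfDensity.of μ (h.toLp φ) := by
  rw [vec_of_memLp h]; rfl

theorem vec_congr (h : φ =ᵐ[(μ : Measure Ω)] ψ) : vec μ φ = vec μ ψ := by
  by_cases hφ : MemLp φ 2 (μ : Measure Ω)
  · rw [vec_of_memLp hφ, vec_of_memLp (hφ.ae_eq h), (MemLp.toLp_eq_toLp_iff _ _).2 h]
  · rw [vec, vec, dif_neg hφ, dif_neg fun hψ => hφ (hψ.ae_eq h.symm)]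

theorem vec_coeFn (φ : Lp ℝ 2 (μ : Measure Ω)) : vec μ φ = tangentEquiv μ φ := by
  rw [vec_of_memLp (Lp.memLp φ), Lp.toLp_coeFn]

theorem vec_density (V : tangent μ) : vec μ (density V) = V := by
  rw [vec_coeFn, density, LinearEquiv.apply_symm_apply]

theorem density_vec (h : MemLp φ 2 (μ : Measure Ω)) :
    density (vec μ φ) =ᵐ[(μ : Measure Ω)] φ := by
  rw [vec_of_memLp h, density, LinearEquiv.symm_apply_apply]
  exact h.coeFn_toLp

theorem vec_add (hφ : MemLp φ 2 (μ : Measure Ω)) (hψ : MemLp ψ 2 (μ : Measure Ω)) :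
    vec μ (fun ω => φ ω + ψ ω) = vec μ φ + vec μ ψ := by
  rw [vec_of_memLp hφ, vec_of_memLp hψ, ← map_add, ← MemLp.toLp_add,
    ← vec_of_memLp (hφ.add hψ)]
  rfl

theorem vec_smul (c : ℝ) (hφ : MemLp φ 2 (μ : Measure Ω)) :
    vec μ (fun ω => c * φ ω) = c • vec μ φ := by
  rw [vec_of_memLp hφ, ← map_smul, ← MemLp.toLp_const_smul, ← vec_of_memLp (hφ.const_smul c)]
  rfl

theorem vec_sum {ι : Type*} (s : Finset ι) {f : ι → Ω → ℝ}
    (hf : ∀ i ∈ s, MemLp (f i) 2 (μ : Measure Ω)) :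
    vec μ (fun ω => ∑ i ∈ s, f i ω) = ∑ i ∈ s, vec μ (f i) := by
  classical
  induction s using Finset.induction_on with
  | empty =>
    have h : MemLp (fun _ : Ω => (0 : ℝ)) 2 (μ : Measure Ω) := MemLp.zero
    simp only [Finset.sum_empty]
    rw [vec_of_memLp h, ← map_zero (tangentEquiv μ)]
    congr 1
  | insert i s hi ih =>
    simp only [Finset.sum_insert hi]
    rw [vec_add (hf i (Finset.mem_insert_self ..))
      (memLp_finsetSum s fun j hj => hf j (Finset.mem_insert_of_mem hj)),
      ih fun j hj => hf j (Finset.mem_insert_of_mem hj)]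

theorem of_changeBase (h : (μ : Measure Ω) ≪ (κ : Measure Ω)) (φ : Lp ℝ 2 (μ : Measure Ω)) :
    HalfDensity.of κ (changeBase ⟨μ⟩ ⟨κ⟩ h φ) = HalfDensity.of μ φ :=
  DirectLimit.Module.of_f (R := ℝ) (f := changeBase) (i := (⟨μ⟩ : DomMeasure Ω)) (j := ⟨κ⟩)
    (hij := h) (x := φ)

theorem memLp_mul_rootDeriv' (h : (μ : Measure Ω) ≪ (κ : Measure Ω))
    (hφ : MemLp φ 2 (μ : Measure Ω)) :
    MemLp (fun ω => φ ω * rootDeriv (μ : Measure Ω) κ ω) 2 (κ : Measure Ω) :=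
  (memLp_mul_rootDeriv h (hφ.toLp φ)).ae_eq (ae_mul_rootDeriv_congr h hφ.coeFn_toLp)

/-- This rebasing lets half-densities over different measures be compared as functions over a common
dominating measure. -/
theorem coe_vec_of_ac (h : (μ : Measure Ω) ≪ (κ : Measure Ω)) (hφ : MemLp φ 2 (μ : Measure Ω)) :
    (vec μ φ : HalfDensity Ω) = vec κ fun ω => φ ω * rootDeriv (μ : Measure Ω) κ ω := by
  rw [coe_vec hφ, coe_vec (memLp_mul_rootDeriv' h hφ), ← of_changeBase h]
  congr 1
  apply Lp.ext
  refine (coeFn_changeBase (μ := ⟨μ⟩) (ν := ⟨κ⟩) h _).trans ?_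
  exact (ae_mul_rootDeriv_congr h hφ.coeFn_toLp).trans (MemLp.coeFn_toLp _).symm

theorem inner_coe_vec (hφ : MemLp φ 2 (μ : Measure Ω)) (hψ : MemLp ψ 2 (μ : Measure Ω)) :
    ⟪(vec μ φ : HalfDensity Ω), (vec μ ψ : HalfDensity Ω)⟫ =
      ∫ ω, φ ω * ψ ω ∂(μ : Measure Ω) := by
  rw [coe_vec hφ, coe_vec hψ, HalfDensity.inner_of]
  refine integral_congr_ae ?_
  filter_upwards [hφ.coeFn_toLp, hψ.coeFn_toLp] with ω h1 h2
  rw [h1, h2]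

theorem HalfDensity.exists_vec_of_ac (μ : FiniteMeasure Ω) (x : HalfDensity Ω) :
    ∃ (κ : FiniteMeasure Ω) (d : Ω → ℝ), (μ : Measure Ω) ≪ (κ : Measure Ω) ∧ Measurable d ∧
      MemLp d 2 (κ : Measure Ω) ∧ x = vec κ d := by
  obtain ⟨ν, φ, rfl⟩ := x.exists_of
  obtain ⟨κ, h1, h2⟩ := exists_ge_ge (⟨μ⟩ : DomMeasure Ω) ⟨ν⟩
  refine ⟨κ.meas, changeBase ⟨ν⟩ κ h2 φ, h1, (Lp.stronglyMeasurable _).measurable, Lp.memLp _, ?_⟩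
  rw [vec_coeFn]
  exact (of_changeBase h2 φ).symm

theorem sqrtMeasure_eq_vec (μ : FiniteMeasure Ω) : sqrtMeasure μ = vec μ fun _ => 1 := by
  rw [coe_vec (memLp_const 1)]
  rfl

theorem sqrtMeasure_eq_vec_of_ac (h : (μ : Measure Ω) ≪ (κ : Measure Ω)) :
    sqrtMeasure μ = vec κ (rootDeriv (μ : Measure Ω) κ) := by
  rw [sqrtMeasure_eq_vec, coe_vec_of_ac h (memLp_const 1)]
  simp

theorem memLp_rootDeriv (h : (μ : Measure Ω) ≪ (κ : Measure Ω)) :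
    MemLp (rootDeriv (μ : Measure Ω) κ) 2 (κ : Measure Ω) := by
  simpa using memLp_mul_rootDeriv' h (memLp_const (1 : ℝ))

theorem exists_ac_ac (μ ν : FiniteMeasure Ω) : ∃ κ : FiniteMeasure Ω,
    (μ : Measure Ω) ≪ (κ : Measure Ω) ∧ (ν : Measure Ω) ≪ (κ : Measure Ω) := by
  obtain ⟨κ, h1, h2⟩ := exists_ge_ge (⟨μ⟩ : DomMeasure Ω) ⟨ν⟩
  exact ⟨κ.meas, h1, h2⟩

theorem sqrtMeasure_eq_vec_of_withDensity {g : Ω → ℝ} (hg : Measurable g) (h0 : ∀ ω, 0 ≤ g ω)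
    (h : (μ : Measure Ω) = (κ : Measure Ω).withDensity fun ω => ENNReal.ofReal (g ω ^ 2)) :
    sqrtMeasure μ = vec κ g := by
  rw [sqrtMeasure_eq_vec_of_ac (κ := κ) (h ▸ withDensity_absolutelyContinuous _ _)]
  congr 1
  refine vec_congr ?_
  have hm : Measurable fun ω => ENNReal.ofReal (g ω ^ 2) := by fun_prop
  filter_upwards [Measure.rnDeriv_withDensity (κ : Measure Ω) hm] with ω hω
  rw [rootDeriv, h, hω, ENNReal.toReal_ofReal (sq_nonneg _), Real.sqrt_sq (h0 ω)]

/-- Expressing `fisher` and `tauOne` through the ambient inner product makes their continuity along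
vector fields immediate. -/
theorem fisher_eq_inner (V W : tangent μ) :
    fisher μ V W = 4 * ⟪(V : HalfDensity Ω), (W : HalfDensity Ω)⟫ := by
  rw [← vec_density V, ← vec_density W, inner_coe_vec (Lp.memLp _) (Lp.memLp _), fisher]
  simp only [vec_density]
  norm_num

theorem tauOne_eq_inner (V : tangent μ) :
    tauOne μ V = 2 * ⟪(V : HalfDensity Ω), sqrtMeasure μ⟫ := by
  rw [← vec_density V, sqrtMeasure_eq_vec, inner_coe_vec (Lp.memLp _) (memLp_const 1), tauOne]
  simp only [vec_density, mul_one]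

/-- Consequently the total mass is continuous for the topology of half-densities. -/
theorem norm_sqrtMeasure_sq (μ : FiniteMeasure Ω) : ‖sqrtMeasure μ‖ ^ 2 = (μ.mass : ℝ) := by
  rw [← real_inner_self_eq_norm_sq, sqrtMeasure_eq_vec,
    inner_coe_vec (memLp_const 1) (memLp_const 1)]
  simp [Measure.real, FiniteMeasure.mass]
  rfl

theorem fisher_vec (hφ : MemLp φ 2 (μ : Measure Ω)) (hψ : MemLp ψ 2 (μ : Measure Ω)) :
    fisher μ (vec μ φ) (vec μ ψ) = 4 * ∫ ω, φ ω * ψ ω ∂(μ : Measure Ω) := by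
  rw [fisher_eq_inner, inner_coe_vec hφ hψ]

theorem tauOne_vec (hφ : MemLp φ 2 (μ : Measure Ω)) :
    tauOne μ (vec μ φ) = 2 * ∫ ω, φ ω ∂(μ : Measure Ω) := by
  rw [tauOne_eq_inner, sqrtMeasure_eq_vec, inner_coe_vec hφ (memLp_const 1)]
  simp

theorem subsingleton_tangent_zero (h : μ = 0) (V : tangent μ) : V = 0 := by
  subst h
  rw [← vec_density V, vec_coeFn, ← map_zero (tangentEquiv 0)]
  congr 1
  apply Lp.ext
  have key : ∀ m : Measure Ω, m = 0 → ∀ P : Ω → Prop, ∀ᵐ ω ∂m, P ω := by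
    rintro _ rfl P
    simp
  exact key _ FiniteMeasure.toMeasure_zero _

end Basics

/-! ### Congruent kernels act on densities by composition with the statistic. -/

section Congruent

variable {Ω Ω' : Type u} [MeasurableSpace Ω] [MeasurableSpace Ω']
  (K : Kernel Ω Ω') [IsMarkovKernel K] {κ : Ω' → Ω}

theorem measurePreserving_push (hκ : Measurable κ) (h : ∀ ω, (K ω).map κ = Measure.dirac ω)
    (μ : FiniteMeasure Ω) : MeasurePreserving κ (push K μ : Measure Ω') (μ : Measure Ω) := by
  refine ⟨hκ, ?_⟩
  have hid : K.map κ = Kernel.id := by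
    ext1 ω
    rw [Kernel.map_apply _ hκ, h, Kernel.id_apply]
  change (K ∘ₘ (μ : Measure Ω)).map κ = μ
  rw [Measure.map_comp _ _ hκ, hid, Measure.id_comp]

/-- Given `ω`, the function `φ ∘ κ` equals `φ ω` almost surely under `K ω`, so it has the integrals
that characterize `pushDensity`. -/
theorem pushDensity_ae_eq (hκ : Measurable κ) (h : ∀ ω, (K ω).map κ = Measure.dirac ω)
    (μ : FiniteMeasure Ω) (φ : Lp ℝ 2 (μ : Measure Ω)) :
    pushDensity K μ φ =ᵐ[(push K μ : Measure Ω')] φ ∘ κ := by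
  have hm : Measurable φ := (Lp.stronglyMeasurable φ).measurable
  have hL : MemLp (φ ∘ κ) 2 (push K μ : Measure Ω') :=
    (Lp.memLp φ).comp_measurePreserving (measurePreserving_push K hκ h μ)
  -- The Dirac measure is tested on the measurable set `{φ = φ ω}`, so points of `Ω` need not be
  -- measurable.
  have hK : ∀ ω, ∀ᵐ ω' ∂K ω, φ (κ ω') = φ ω := by
    intro ω
    have h1 : ∀ᵐ x ∂(K ω).map κ, φ x = φ ω := by
      rw [h, ae_dirac_iff (measurableSet_eq_fun hm measurable_const)]
    exact ae_of_ae_map hκ.aemeasurable h1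
  set ρ : Measure (Ω × Ω') := (μ : Measure Ω) ⊗ₘ K with hρ
  have hfst : MeasurePreserving Prod.fst ρ (μ : Measure Ω) :=
    ⟨measurable_fst, Measure.fst_compProd (μ : Measure Ω) K⟩
  have hsnd : MeasurePreserving Prod.snd ρ (push K μ : Measure Ω') :=
    ⟨measurable_snd, Measure.snd_compProd (μ : Measure Ω) K⟩
  have hfi : Integrable (fun x : Ω × Ω' => φ x.1) ρ :=
    ((Lp.memLp φ).comp_measurePreserving hfst).integrable one_le_two
  have hae : ∀ᵐ x ∂ρ, φ (κ x.2) = φ x.1 :=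
    Measure.ae_compProd_of_ae_ae (measurableSet_eq_fun (by fun_prop) (by fun_prop))
      (.of_forall hK)
  have hu := pushDensity_unique K μ φ (hL.toLp _) fun A' hA' => by
    calc ∫ ω' in A', (hL.toLp _) ω' ∂(push K μ : Measure Ω')
        = ∫ ω' in A', φ (κ ω') ∂(push K μ : Measure Ω') :=
          integral_congr_ae (ae_restrict_of_ae hL.coeFn_toLp)
      _ = ∫ x in Prod.snd ⁻¹' A', φ (κ x.2) ∂ρ := by
          rw [← hsnd.map_eq]
          exact setIntegral_map hA' (hm.comp hκ).aestronglyMeasurable measurable_snd.aemeasurable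
      _ = ∫ x in univ ×ˢ A', φ x.1 ∂ρ := by
          rw [univ_prod]
          exact integral_congr_ae (ae_restrict_of_ae hae)
      _ = ∫ ω, (K ω).real A' * φ ω ∂(μ : Measure Ω) := by
          rw [Measure.setIntegral_compProd MeasurableSet.univ hA' hfi.integrableOn]
          simp
  rw [hu]
  exact hL.coeFn_toLp

theorem formalDeriv_vec (hκ : Measurable κ) (h : ∀ ω, (K ω).map κ = Measure.dirac ω)
    (μ : FiniteMeasure Ω) {φ : Ω → ℝ} (hφ : MemLp φ 2 (μ : Measure Ω)) :
    formalDeriv K μ (vec μ φ) = vec (push K μ) (φ ∘ κ) := by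
  have h1 : formalDeriv K μ (vec μ φ) =
      tangentEquiv (push K μ) (pushDensity K μ (density (vec μ φ))) := rfl
  rw [h1, ← vec_coeFn]
  refine vec_congr ((pushDensity_ae_eq K hκ h μ _).trans ?_)
  exact (measurePreserving_push K hκ h μ).quasiMeasurePreserving.ae_eq_comp (density_vec hφ)

variable {Θ : ∀ (Ω : Type u) [MeasurableSpace Ω], TwoTensorField Ω}

theorem IsCongruentFamily.form_push (hΘ : IsCongruentFamily Θ) (hκ : Measurable κ)
    (h : ∀ ω, (K ω).map κ = Measure.dirac ω) (μ : FiniteMeasure Ω) {φ ψ : Ω → ℝ}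
    (hφ : MemLp φ 2 (μ : Measure Ω)) (hψ : MemLp ψ 2 (μ : Measure Ω)) :
    (Θ Ω').form (push K μ) (vec _ (φ ∘ κ)) (vec _ (ψ ∘ κ)) =
      (Θ Ω).form μ (vec μ φ) (vec μ ψ) := by
  rw [← hΘ Ω Ω' K ⟨κ, hκ, h⟩ μ, ← formalDeriv_vec K hκ h μ hφ, ← formalDeriv_vec K hκ h μ hψ]
  rfl

end Congruent

/-! ### Reduction to finite spaces. -/

section FinitePartition

variable {Ω I : Type u} [MeasurableSpace Ω] [MeasurableSpace I] [Fintype I]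
  [DiscreteMeasurableSpace I]

open Classical in
/-- The Markov kernel `i ↦ μ(· | f = i) ⊗ δ_i`; where `f = i` is a null set, the conditional
measure is replaced by `δ_{ω₀}`. -/
noncomputable def fiberKernel (μ : Measure Ω) (f : Ω → I) (ω₀ : Ω) : Kernel I (Ω × I) :=
  Kernel.ofFunOfCountable fun i =>
    (if μ (f ⁻¹' {i}) = 0 then Measure.dirac ω₀ else μ[|f ⁻¹' {i}]).prod (Measure.dirac i)

variable (μ : Measure Ω) [IsFiniteMeasure μ] {f : Ω → I} (ω₀ : Ω)

instance : IsMarkovKernel (fiberKernel μ f ω₀) where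
  isProbabilityMeasure i := by
    change IsProbabilityMeasure ((if μ (f ⁻¹' {i}) = 0 then Measure.dirac ω₀ else
      μ[|f ⁻¹' {i}]).prod (Measure.dirac i))
    split_ifs with h
    · infer_instance
    · have := cond_isProbabilityMeasure h
      infer_instance

theorem map_snd_fiberKernel (i : I) :
    (fiberKernel μ f ω₀ i).map Prod.snd = Measure.dirac i := by
  change ((if μ (f ⁻¹' {i}) = 0 then Measure.dirac ω₀ else
      μ[|f ⁻¹' {i}]).prod (Measure.dirac i)).map Prod.snd = _
  split_ifs with h
  · rw [Measure.map_snd_prod]; simp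
  · have := cond_isProbabilityMeasure h
    rw [Measure.map_snd_prod]; simp

/-- This disintegrates the graph measure along `f`. The arbitrary choice on null fibres is
multiplied by weight zero. -/
theorem fiberKernel_comp_map (hf : Measurable f) :
    fiberKernel μ f ω₀ ∘ₘ μ.map f = μ.map fun ω => (ω, f ω) := by
  classical
  ext S hS
  rw [Measure.bind_apply hS (Kernel.aemeasurable _), lintegral_fintype,
    Measure.map_apply (by fun_prop) hS]
  have hdis : μ ((fun ω => (ω, f ω)) ⁻¹' S) =
      ∑ i, μ (f ⁻¹' {i} ∩ (fun ω => (ω, i)) ⁻¹' S) := by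
    rw [← measure_biUnion_finset]
    · congr 1
      ext ω
      simp
    · intro i _ j _ hij
      refine Set.disjoint_left.2 ?_
      rintro ω ⟨h1, _⟩ ⟨h2, _⟩
      exact hij (h1.symm.trans h2)
    · intro i _
      exact (hf (measurableSet_singleton i)).inter (measurable_prodMk_right hS)
  rw [hdis]
  refine Finset.sum_congr rfl fun i _ => ?_
  rw [Measure.map_apply hf (measurableSet_singleton i)]
  change ((if μ (f ⁻¹' {i}) = 0 then Measure.dirac ω₀ else
      μ[|f ⁻¹' {i}]).prod (Measure.dirac i)) S * _ = _
  split_ifs with h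
  · rw [h, mul_zero, measure_mono_null inter_subset_left h]
  · have := cond_isProbabilityMeasure h
    rw [Measure.prod_dirac, Measure.map_apply (by fun_prop) hS,
      cond_apply (hf (measurableSet_singleton i)), mul_comm, ← mul_assoc,
      ENNReal.mul_inv_cancel h (measure_ne_top _ _), one_mul]

variable {Θ : ∀ (Ω : Type u) [MeasurableSpace Ω], TwoTensorField Ω}

theorem memLp_finite {μ : FiniteMeasure Ω} {f : Ω → I} (hf : Measurable f) (x : I → ℝ) :
    MemLp (x ∘ f) 2 (μ : Measure Ω) := by
  refine MemLp.of_bound (C := ∑ i, |x i|)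
    ((measurable_of_finite x).comp hf).aestronglyMeasurable (.of_forall fun ω => ?_)
  exact Finset.single_le_sum (f := fun i => |x i|) (fun i _ => abs_nonneg _)
    (Finset.mem_univ (f ω))

/-- A congruent family evaluated on functions of a finite-valued `f` only depends on the law
of `f`. -/
theorem IsCongruentFamily.form_comp (hΘ : IsCongruentFamily Θ) (μ : FiniteMeasure Ω)
    {f : Ω → I} (hf : Measurable f) (x y : I → ℝ) :
    (Θ Ω).form μ (vec μ (x ∘ f)) (vec μ (y ∘ f)) =
      (Θ I).form (μ.map f) (vec _ x) (vec _ y) := by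
  rcases isEmpty_or_nonempty Ω with hΩ | ⟨⟨ω₀⟩⟩
  · have h0 : μ = 0 := Subtype.ext (Measure.eq_zero_of_isEmpty _)
    have h1 : μ.map f = 0 := by
      subst h0
      apply Subtype.ext
      simp [FiniteMeasure.map]
    rw [subsingleton_tangent_zero h0 (vec μ (x ∘ f)),
      subsingleton_tangent_zero h1 (vec (μ.map f) x)]
    simp
  have hg : Measurable fun ω => (ω, f ω) := by fun_prop
  have hmap : (μ.map f : Measure I) = (μ : Measure Ω).map f :=
    FiniteMeasure.toMeasure_map _ _
  set K₁ : Kernel Ω (Ω × I) := Kernel.deterministic _ hg with hK₁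
  set K₂ := fiberKernel (μ : Measure Ω) f ω₀
  -- Both pushed measures are the law of `(ω, f ω)`, so the two invariances can be chained.
  have hp : push K₂ (μ.map f) = push K₁ μ := by
    apply Subtype.ext
    change K₂ ∘ₘ (μ.map f : Measure I) = K₁ ∘ₘ (μ : Measure Ω)
    rw [hmap, Measure.deterministic_comp_eq_map, fiberKernel_comp_map _ _ hf]
  have h1 := hΘ.form_push K₁ (κ := Prod.fst) measurable_fst (fun ω => by
    rw [hK₁, Kernel.deterministic_apply, Measure.map_dirac' measurable_fst]) μ
    (memLp_finite (μ := μ) hf x) (memLp_finite (μ := μ) hf y)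
  have h2 := hΘ.form_push K₂ (κ := Prod.snd) measurable_snd
    (map_snd_fiberKernel (μ : Measure Ω) ω₀) (μ.map f)
    (memLp_finite (μ := μ.map f) measurable_id x) (memLp_finite (μ := μ.map f) measurable_id y)
  rw [← h1]
  refine Eq.trans ?_ h2
  rw [hp]
  -- The graph measure is carried by the graph of `f`, where the two pulled-back functions coincide.
  have hae : ∀ z : I → ℝ, (z ∘ f) ∘ Prod.fst =ᵐ[(push K₁ μ : Measure (Ω × I))] z ∘ Prod.snd := by
    intro z
    change ∀ᵐ p ∂(K₁ ∘ₘ (μ : Measure Ω)), z (f p.1) = z p.2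
    rw [Measure.deterministic_comp_eq_map]
    refine (ae_map_iff hg.aemeasurable (measurableSet_eq_fun ?_ ?_)).2 (.of_forall fun ω => rfl)
    · exact (measurable_of_finite z).comp (hf.comp measurable_fst)
    · exact (measurable_of_finite z).comp measurable_snd
  rw [vec_congr (hae x), vec_congr (hae y)]
  rfl

end FinitePartition

/-! ### Construction of vector fields with prescribed values. -/

section Fields

variable {Ω : Type u} [MeasurableSpace Ω]

theorem continuousOnSqrt_iff {Y : Type*} [TopologicalSpace Y] {F : FiniteMeasure Ω → Y} :
    ContinuousOnSqrt F ↔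
      ∀ μ, Tendsto F (comap sqrtMeasure (𝓝 (sqrtMeasure μ))) (𝓝 (F μ)) := by
  simp only [ContinuousOnSqrt, ← nhds_induced]
  let : TopologicalSpace (FiniteMeasure Ω) := TopologicalSpace.induced sqrtMeasure inferInstance
  exact continuous_iff_continuousAt

theorem ContinuousOnSqrt.tendsto {Y : Type*} [TopologicalSpace Y] {F : FiniteMeasure Ω → Y}
    (hF : ContinuousOnSqrt F) {ι : Type*} {l : Filter ι} {g : ι → FiniteMeasure Ω}
    {μ : FiniteMeasure Ω} (hg : Tendsto (fun i => sqrtMeasure (g i)) l (𝓝 (sqrtMeasure μ))) :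
    Tendsto (fun i => F (g i)) l (𝓝 (F μ)) :=
  (continuousOnSqrt_iff.1 hF μ).comp (tendsto_comap_iff.2 hg)

theorem coe_vec_sub {μ : FiniteMeasure Ω} {φ ψ : Ω → ℝ} (hφ : MemLp φ 2 (μ : Measure Ω))
    (hψ : MemLp ψ 2 (μ : Measure Ω)) :
    (vec μ φ - vec μ ψ : HalfDensity Ω) = HalfDensity.of μ ((hφ.sub hψ).toLp _) := by
  rw [coe_vec hφ, coe_vec hψ, ← map_sub, MemLp.toLp_sub]

/-- Over a common dominating measure the difference is `φ` times the difference of the two root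
densities. Thus a bounded density defines a Lipschitz field. -/
theorem norm_vec_sub_vec_le (μ ν : FiniteMeasure Ω) {φ : Ω → ℝ} (hφ : Measurable φ) {C : ℝ}
    (hC : ∀ ω, |φ ω| ≤ C) :
    ‖(vec μ φ - vec ν φ : HalfDensity Ω)‖ ≤ C * ‖sqrtMeasure μ - sqrtMeasure ν‖ := by
  obtain ⟨κ, h1, h2⟩ := exists_ac_ac μ ν
  have hL : ∀ m : FiniteMeasure Ω, MemLp φ 2 (m : Measure Ω) := fun m =>
    MemLp.of_bound hφ.aestronglyMeasurable C (.of_forall hC)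
  rw [coe_vec_of_ac h1 (hL μ), coe_vec_of_ac h2 (hL ν), sqrtMeasure_eq_vec_of_ac h1,
    sqrtMeasure_eq_vec_of_ac h2, coe_vec_sub (memLp_mul_rootDeriv' h1 (hL μ))
    (memLp_mul_rootDeriv' h2 (hL ν)), coe_vec_sub (memLp_rootDeriv h1) (memLp_rootDeriv h2),
    LinearIsometry.norm_map, LinearIsometry.norm_map]
  refine Lp.norm_le_mul_norm_of_ae_le_mul ?_
  filter_upwards [MemLp.coeFn_toLp ((memLp_mul_rootDeriv' h1 (hL μ)).sub
    (memLp_mul_rootDeriv' h2 (hL ν))),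
    MemLp.coeFn_toLp ((memLp_rootDeriv h1).sub (memLp_rootDeriv h2))] with ω e1 e2
  rw [e1, e2]
  simp only [Pi.sub_apply]
  rw [← mul_sub, norm_mul]
  exact mul_le_mul_of_nonneg_right (hC ω) (norm_nonneg _)

theorem continuousOnSqrt_vec {φ : Ω → ℝ} (hφ : Measurable φ) {C : ℝ} (hC : ∀ ω, |φ ω| ≤ C) :
    ContinuousOnSqrt fun μ => (vec μ φ : HalfDensity Ω) := by
  rw [continuousOnSqrt_iff]
  intro μ
  rw [tendsto_iff_norm_sub_tendsto_zero]
  have h1 : Tendsto (fun ν => C * ‖sqrtMeasure ν - sqrtMeasure μ‖)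
      (comap sqrtMeasure (𝓝 (sqrtMeasure μ))) (𝓝 0) := by
    have := (tendsto_iff_norm_sub_tendsto_zero.1
      (tendsto_comap (f := sqrtMeasure (Ω := Ω)) (x := 𝓝 (sqrtMeasure μ)))).const_mul C
    simpa using this
  exact squeeze_zero (fun _ => norm_nonneg _) (fun ν => norm_vec_sub_vec_le ν μ hφ hC) h1

/-- The vector field `μ ↦ φ μ^{1/2}` for a bounded measurable function `φ`. -/
noncomputable def boundedField (φ : Ω → ℝ) (hφ : Measurable φ) (C : ℝ) (hC : ∀ ω, |φ ω| ≤ C) :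
    VectorField Ω where
  toFun μ := vec μ φ
  continuous_toFun := continuousOnSqrt_vec hφ hC

theorem exists_bound (f : SimpleFunc Ω ℝ) : ∃ C, 1 ≤ C ∧ ∀ ω, |f ω| ≤ C := by
  obtain ⟨C, hC⟩ := f.exists_forall_norm_le
  exact ⟨max 1 C, le_max_left .., fun ω => (hC ω).trans (le_max_right ..)⟩

theorem memLp_simple (μ : FiniteMeasure Ω) (f : SimpleFunc Ω ℝ) :
    MemLp f 2 (μ : Measure Ω) :=
  f.memLp_of_isFiniteMeasure _ _

/-- The tangent vectors `φ μ^{1/2}` with `φ` a simple function. -/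
noncomputable def simpleTangent (μ : FiniteMeasure Ω) : Submodule ℝ (tangent μ) where
  carrier := {V | ∃ f : SimpleFunc Ω ℝ, V = vec μ f}
  add_mem' := by
    rintro _ _ ⟨f, rfl⟩ ⟨g, rfl⟩
    exact ⟨f + g, (vec_add (memLp_simple μ f) (memLp_simple μ g)).symm⟩
  zero_mem' := by
    refine ⟨0, ?_⟩
    have h := vec_smul (μ := μ) 0 (memLp_simple μ 0)
    rw [zero_smul] at h
    rw [← h]
    exact vec_congr (.of_forall fun ω => by simp)
  smul_mem' := by
    rintro c _ ⟨f, rfl⟩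
    exact ⟨c • f, (vec_smul c (memLp_simple μ f)).symm⟩

theorem closure_simpleTangent (μ : FiniteMeasure Ω) (V : tangent μ) :
    V ∈ closure (simpleTangent μ : Set (tangent μ)) := by
  rw [Metric.mem_closure_iff]
  intro ε hε
  obtain ⟨f, hf, hf'⟩ := (Lp.memLp (density V)).exists_simpleFunc_eLpNorm_sub_lt
    ENNReal.ofNat_ne_top (ENNReal.ofReal_pos.2 hε).ne'
  refine ⟨vec μ f, ⟨f, rfl⟩, ?_⟩
  rw [dist_eq_norm, ← vec_density V]
  change ‖(vec μ (density V) - vec μ f : HalfDensity Ω)‖ < ε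
  rw [coe_vec_sub (Lp.memLp _) hf', LinearIsometry.norm_map, Lp.norm_toLp]
  exact (ENNReal.toReal_lt_of_lt_ofReal hf)

/-- The tangent cone is an isometric copy of L², so absolutely convergent series of tangent vectors
stay in it. -/
instance (μ : FiniteMeasure Ω) : CompleteSpace (tangent μ) := by
  refine completeSpace_coe_iff_isComplete.2 ?_
  change IsComplete (Set.range (HalfDensity.of μ))
  exact (HalfDensity.of μ).isometry.isUniformInducing.isComplete_range

/-- A cutoff function on `ℳ^{1/2}(Ω)` which is `1` at `μ` and vanishes at distance `1 / L`. -/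
noncomputable def cutoff (μ : FiniteMeasure Ω) (L : ℝ) (ν : FiniteMeasure Ω) : ℝ :=
  max 0 (1 - L * ‖sqrtMeasure ν - sqrtMeasure μ‖)

theorem cutoff_nonneg (μ : FiniteMeasure Ω) (L : ℝ) (ν : FiniteMeasure Ω) : 0 ≤ cutoff μ L ν :=
  le_max_left ..

theorem cutoff_self (μ : FiniteMeasure Ω) (L : ℝ) : cutoff μ L μ = 1 := by simp [cutoff]

theorem continuousOnSqrt_cutoff (μ : FiniteMeasure Ω) (L : ℝ) :
    ContinuousOnSqrt (cutoff μ L) := by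
  have h : Continuous fun x : HalfDensity Ω => max 0 (1 - L * ‖x - sqrtMeasure μ‖) := by
    fun_prop
  let : TopologicalSpace (FiniteMeasure Ω) := TopologicalSpace.induced sqrtMeasure inferInstance
  exact h.comp (f := sqrtMeasure) continuous_induced_dom

/-- Where the cutoff is nonzero, the distance of the roots is below `1 / (s * C)`, so by the
Lipschitz estimate moving from `μ` to `ν` costs at most `s⁻¹` in norm. -/
theorem norm_cutoff_smul_le (μ ν : FiniteMeasure Ω) {φ : Ω → ℝ} (hφ : Measurable φ) {C s : ℝ}
    (hC : ∀ ω, |φ ω| ≤ C) (hC1 : 1 ≤ C) (hs : 0 < s) :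
    ‖cutoff μ (s * C) ν • vec ν φ‖ ≤ ‖vec μ φ‖ + s⁻¹ := by
  have h0 := norm_nonneg (sqrtMeasure ν - sqrtMeasure μ)
  rw [norm_smul, Real.norm_of_nonneg (cutoff_nonneg ..)]
  have h1 : ‖vec ν φ‖ ≤ ‖vec μ φ‖ + C * ‖sqrtMeasure ν - sqrtMeasure μ‖ := by
    have h2 := norm_vec_sub_vec_le ν μ hφ hC
    have h3 := norm_le_insert' (vec ν φ : HalfDensity Ω) (vec μ φ)
    exact h3.trans (by rw [Submodule.coe_norm]; linarith)
  have hle : cutoff μ (s * C) ν ≤ 1 := by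
    rw [cutoff]
    refine max_le zero_le_one ?_
    nlinarith [mul_nonneg (mul_nonneg hs.le (zero_le_one.trans hC1)) h0]
  rcases le_or_gt 1 (s * C * ‖sqrtMeasure ν - sqrtMeasure μ‖) with h | h
  · have hc : cutoff μ (s * C) ν = 0 := by
      rw [cutoff]
      exact max_eq_left (by linarith)
    rw [hc, zero_mul]
    positivity
  · have h4 : C * ‖sqrtMeasure ν - sqrtMeasure μ‖ ≤ s⁻¹ := by
      rw [← one_div, le_div_iff₀ hs]
      linarith
    calc cutoff μ (s * C) ν * ‖vec ν φ‖ ≤ 1 * ‖vec ν φ‖ :=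
          mul_le_mul_of_nonneg_right hle (norm_nonneg _)
      _ ≤ _ := by linarith

/-- Every tangent vector extends to a vector field which is given by simple functions at all other
points. -/
theorem exists_vectorField (μ : FiniteMeasure Ω) (V : tangent μ) :
    ∃ X : VectorField Ω, X.toFun μ = V ∧ ∀ ν, ν ≠ μ → X.toFun ν ∈ simpleTangent ν := by
  -- `V` is a series of simple vectors; the n-th term is localized to a ball around the root of `μ`
  -- that shrinks with `n`. The series is uniformly convergent, and away from `μ` it is a finite
  -- sum.
  obtain ⟨v, hv, hvs, -, hvb⟩ := controlled_sum_of_mem_closure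
    (s := (simpleTangent μ).toAddSubgroup) (a := V) (closure_simpleTangent μ V)
    (b := fun n => (1 / 2 : ℝ) ^ n) (fun n => by positivity)
  choose g hg using hvs
  choose C hC1 hC using fun n => exists_bound (g n)
  have hgsum : Summable fun n => ‖vec μ (g n)‖ := by
    -- The geometric bound on the terms holds from index 1 on; the first term only has to be finite.
    rw [← summable_nat_add_iff 1]
    refine Summable.of_nonneg_of_le (fun _ => norm_nonneg _) (fun n => ?_)
      ((summable_nat_add_iff 1).2 summable_geometric_two)
    rw [← hg]
    exact (hvb (n + 1) n.succ_pos).le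
  set c : ℕ → FiniteMeasure Ω → ℝ := fun n => cutoff μ (2 ^ n * C n) with hc
  have hu : Summable fun n => ‖vec μ (g n)‖ + ((2 : ℝ) ^ n)⁻¹ := by
    refine hgsum.add ?_
    simpa using summable_geometric_two
  have hb : ∀ n ν, ‖c n ν • vec ν (g n)‖ ≤ ‖vec μ (g n)‖ + ((2 : ℝ) ^ n)⁻¹ := fun n ν =>
    norm_cutoff_smul_le μ ν (g n).measurable (hC n) (hC1 n) (by positivity)
  have hs : ∀ ν, Summable fun n => c n ν • vec ν (g n) := fun ν =>
    Summable.of_norm_bounded hu fun n => hb n ν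
  -- The Weierstrass test needs a complete target, so continuity is checked after embedding in the
  -- completion.
  have hcoe : ∀ ν, ((∑' n, c n ν • vec ν (g n) : tangent ν) : UniformSpace.Completion
      (HalfDensity Ω)) = ∑' n, ((c n ν • vec ν (g n) : HalfDensity Ω) :
        UniformSpace.Completion (HalfDensity Ω)) := by
    intro ν
    exact (((hs ν).hasSum.mapL (tangent ν).subtypeL).mapL
      (UniformSpace.Completion.toComplL (𝕜 := ℝ))).tsum_eq.symm
  refine ⟨⟨fun ν => ∑' n, c n ν • vec ν (g n), ?_⟩, ?_, ?_⟩
  · have hterm : ∀ n, ContinuousOnSqrt fun ν => ((c n ν • vec ν (g n) : HalfDensity Ω)) := by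
      intro n
      have h1 := continuousOnSqrt_cutoff μ (2 ^ n * C n)
      have h2 := continuousOnSqrt_vec (g n).measurable (hC n)
      rw [continuousOnSqrt_iff] at h1 h2 ⊢
      exact fun ν => (h1 ν).smul (h2 ν)
    let : TopologicalSpace (FiniteMeasure Ω) := TopologicalSpace.induced sqrtMeasure inferInstance
    change Continuous _
    rw [(UniformSpace.Completion.isUniformInducing_coe (HalfDensity Ω)).isInducing.continuous_iff]
    refine (continuous_congr hcoe).2 (continuous_tsum (fun n => ?_) hu fun n ν => ?_)
    · exact (UniformSpace.Completion.continuous_coe _).comp (hterm n)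
    · rw [UniformSpace.Completion.norm_coe]
      exact hb n ν
  · change ∑' n, c n μ • vec μ (g n) = V
    have h1 : ∀ n, c n μ • vec μ (g n) = v n := fun n => by
      rw [hc, hg]
      simp only [cutoff_self, one_smul]
    have h2 := (hs μ).hasSum.tendsto_sum_nat.comp (tendsto_add_atTop_nat 1)
    simp only [h1] at h2 ⊢
    exact tendsto_nhds_unique h2 hv
  · intro ν hν
    have hd : 0 < ‖sqrtMeasure ν - sqrtMeasure μ‖ :=
      norm_pos_iff.2 (sub_ne_zero.2 fun h => hν (sqrtMeasure_injective h))
    -- From index `N` on, `ν` lies outside the support of the cutoff, since its radius is at most `1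
    -- / 2 ^ n`.
    obtain ⟨N, hN⟩ := pow_unbounded_of_one_lt (‖sqrtMeasure ν - sqrtMeasure μ‖)⁻¹ one_lt_two
    have hz : ∀ n ∉ Finset.range N, c n ν • vec ν (g n) = 0 := by
      intro n hn
      have hle : N ≤ n := by simpa using hn
      have h1 : (‖sqrtMeasure ν - sqrtMeasure μ‖)⁻¹ ≤ 2 ^ n * C n := by
        calc _ ≤ (2 : ℝ) ^ N := hN.le
          _ ≤ 2 ^ n := pow_le_pow_right₀ one_le_two hle
          _ ≤ 2 ^ n * C n := le_mul_of_one_le_right (by positivity) (hC1 n)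
      have h2 : 1 ≤ 2 ^ n * C n * ‖sqrtMeasure ν - sqrtMeasure μ‖ := by
        rwa [inv_le_iff_one_le_mul₀ hd] at h1
      have h3 : c n ν = 0 := max_eq_left (by linarith)
      rw [h3, zero_smul]
    change ∑' n, c n ν • vec ν (g n) ∈ _
    rw [tsum_eq_sum hz]
    exact Submodule.sum_mem _ fun n _ => Submodule.smul_mem _ _ ⟨g n, rfl⟩

end Fields

/-! ### Measures on finite sets as weight vectors. -/

section Weighted

instance {α : Type*} [MeasurableSpace α] [DiscreteMeasurableSpace α] :
    DiscreteMeasurableSpace (ULift.{u} α) :=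
  ⟨fun s => by
    have h : MeasurableSet (ULift.down (α := α) ⁻¹' (ULift.down '' s)) :=
      measurable_down (.of_discrete)
    rwa [ULift.down_injective.preimage_image] at h⟩

variable {J : Type u} [MeasurableSpace J] [Fintype J] [DiscreteMeasurableSpace J]

/-- The measure `∑ j, w j • δ_j` on a finite set. -/
noncomputable def weighted (w : J → ℝ≥0) : FiniteMeasure J :=
  ⟨Measure.count.withDensity fun j => (w j : ℝ≥0∞), by
    refine isFiniteMeasure_withDensity ?_
    rw [lintegral_fintype]
    simp [ENNReal.sum_eq_top]⟩

/-- The counting measure on a finite set. -/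
noncomputable def countMeasure (J : Type u) [MeasurableSpace J] [Fintype J]
    [DiscreteMeasurableSpace J] : FiniteMeasure J :=
  ⟨Measure.count, inferInstance⟩

open Classical in
theorem weighted_apply (w : J → ℝ≥0) (s : Set J) :
    (weighted w : Measure J) s = ∑ j, if j ∈ s then (w j : ℝ≥0∞) else 0 := by
  change Measure.count.withDensity (fun j => (w j : ℝ≥0∞)) s = _
  rw [withDensity_apply _ (.of_discrete), ← lintegral_indicator (.of_discrete), lintegral_fintype]
  simp [Set.indicator_apply]

theorem weighted_real_singleton (w : J → ℝ≥0) (j : J) :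
    (weighted w : Measure J).real {j} = w j := by
  classical
  simp [Measure.real, weighted_apply]

theorem integral_weighted (w : J → ℝ≥0) (x : J → ℝ) :
    ∫ j, x j ∂(weighted w : Measure J) = ∑ j, w j * x j := by
  rw [integral_fintype (Integrable.of_finite)]
  simp only [weighted_real_singleton, smul_eq_mul]

theorem eq_weighted_of_singleton {μ : FiniteMeasure J} {w : J → ℝ≥0}
    (h : ∀ j, (μ : Measure J) {j} = w j) : μ = weighted w := by
  classical
  apply Subtype.ext
  refine Measure.ext_of_singleton fun j => ?_
  refine (h j).trans (Eq.trans ?_ (weighted_apply w {j}).symm)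
  simp

theorem eq_weighted (μ : FiniteMeasure J) : μ = weighted fun j => μ {j} :=
  eq_weighted_of_singleton fun j => by simp

theorem mass_weighted (w : J → ℝ≥0) : (weighted w).mass = ∑ j, w j := by
  classical
  have h := weighted_apply w univ
  simp only [mem_univ, if_true] at h
  rw [← ENNReal.coe_inj, FiniteMeasure.ennreal_mass, h]
  simp

theorem memLp_fintype (μ : FiniteMeasure J) (x : J → ℝ) : MemLp x 2 (μ : Measure J) :=
  memLp_finite (μ := μ) measurable_id x

/-- Relative to counting measure the root has coordinates `√(w j)`, which are continuous in the
weights. -/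
theorem continuous_sqrtMeasure_weighted :
    Continuous fun w : J → ℝ≥0 => sqrtMeasure (weighted w) := by
  classical
  have key : ∀ w : J → ℝ≥0, sqrtMeasure (weighted w) =
      ∑ j, √(w j : ℝ) • (vec (countMeasure J) (Pi.single j 1) : HalfDensity J) := by
    intro w
    rw [sqrtMeasure_eq_vec_of_withDensity (κ := countMeasure J) (g := fun j => √(w j : ℝ))
      (measurable_of_finite _) (fun _ => Real.sqrt_nonneg _)]
    · have h := vec_sum (μ := countMeasure J) Finset.univ
        (f := fun j i => √(w j : ℝ) * (Pi.single j 1 : J → ℝ) i) fun j _ => memLp_fintype _ _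
      have h' : (fun i => ∑ j, √(w j : ℝ) * (Pi.single j 1 : J → ℝ) i) =
          fun i => √(w i : ℝ) := by
        ext i
        simp [Pi.single_apply]
      rw [← h', h, AddSubmonoidClass.coe_finsetSum]
      refine Finset.sum_congr rfl fun j _ => ?_
      rw [vec_smul _ (memLp_fintype _ _), Submodule.coe_smul]
    · change Measure.count.withDensity (fun j => (w j : ℝ≥0∞)) = Measure.count.withDensity _
      congr 1
      ext j
      rw [Real.sq_sqrt (w j).coe_nonneg, ENNReal.ofReal_coe_nnreal]
  simp only [key]
  fun_prop

omit [MeasurableSpace J] [DiscreteMeasurableSpace J] in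
theorem exists_bound_finite (x : J → ℝ) : ∀ j, |x j| ≤ ∑ j, |x j| := fun j =>
  Finset.single_le_sum (f := fun i => |x i|) (fun _ _ => abs_nonneg _) (Finset.mem_univ j)

/-- The vector field with constant density `x` on a finite set. -/
noncomputable def finiteField (x : J → ℝ) : VectorField J :=
  boundedField x (measurable_of_finite x) _ (exists_bound_finite x)

end Weighted

/-! ### The defect and its invariance. -/

section Defect

variable {Ω : Type u} [MeasurableSpace Ω]

/-- `tauOne` as a linear form. -/
noncomputable def tauOneLinear (μ : FiniteMeasure Ω) : tangent μ →ₗ[ℝ] ℝ :=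
  (2 : ℝ) • (innerₗ (HalfDensity Ω) (sqrtMeasure μ)) ∘ₗ (tangent μ).subtype

theorem tauOneLinear_apply (μ : FiniteMeasure Ω) (V : tangent μ) :
    tauOneLinear μ V = tauOne μ V := by
  rw [tauOne_eq_inner, real_inner_comm]
  rfl

/-- The difference between a `2`-tensor field and `a(‖μ‖) 𝔤_F + b(‖μ‖) τ¹ ⊗ τ¹`. -/
noncomputable def defect (Ψ : TwoTensorField Ω) (a b : ℝ → ℝ) (μ : FiniteMeasure Ω) :
    LinearMap.BilinForm ℝ (tangent μ) :=
  Ψ.form μ - (a μ.mass * 4) •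
      (innerₗ (HalfDensity Ω)).compl₁₂ (tangent μ).subtype (tangent μ).subtype -
    b μ.mass • (LinearMap.mul ℝ ℝ).compl₁₂ (tauOneLinear μ) (tauOneLinear μ)

theorem defect_apply (Ψ : TwoTensorField Ω) (a b : ℝ → ℝ) (μ : FiniteMeasure Ω)
    (V W : tangent μ) : defect Ψ a b μ V W = Ψ.form μ V W - a μ.mass * fisher μ V W -
      b μ.mass * (tauOne μ V * tauOne μ W) := by
  rw [fisher_eq_inner, ← tauOneLinear_apply, ← tauOneLinear_apply, ← mul_assoc]
  rfl

theorem defect_zero (Ψ : TwoTensorField Ω) (a b : ℝ → ℝ) {μ : FiniteMeasure Ω} (h : μ = 0)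
    (V W : tangent μ) : defect Ψ a b μ V W = 0 := by
  rw [subsingleton_tangent_zero h V, map_zero, LinearMap.zero_apply]

/-- The limit must be nonzero because `a` and `b` are controlled only at positive masses. -/
theorem tendsto_defect (Ψ : TwoTensorField Ω) {a b : ℝ → ℝ} (ha : ContinuousOn a (Ioi 0))
    (hb : ContinuousOn b (Ioi 0)) (X Y : VectorField Ω) {ι : Type*} {l : Filter ι}
    {g : ι → FiniteMeasure Ω} {μ : FiniteMeasure Ω} (hμ : μ ≠ 0)
    (hg : Tendsto (fun i => sqrtMeasure (g i)) l (𝓝 (sqrtMeasure μ))) :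
    Tendsto (fun i => defect Ψ a b (g i) (X.toFun (g i)) (Y.toFun (g i))) l
      (𝓝 (defect Ψ a b μ (X.toFun μ) (Y.toFun μ))) := by
  have hX := X.continuous_toFun.tendsto hg
  have hY := Y.continuous_toFun.tendsto hg
  have hm : Tendsto (fun i => ((g i).mass : ℝ)) l (𝓝 (μ.mass : ℝ)) := by
    simp only [← norm_sqrtMeasure_sq]
    exact hg.norm.pow 2
  have hpos : (0 : ℝ) < μ.mass := by
    have := (FiniteMeasure.mass_nonzero_iff μ).2 hμ
    positivity
  have ha' := ((ha.continuousAt (Ioi_mem_nhds hpos)).tendsto).comp hm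
  have hb' := ((hb.continuousAt (Ioi_mem_nhds hpos)).tendsto).comp hm
  simp only [defect_apply, fisher_eq_inner, tauOne_eq_inner]
  exact (((Ψ.continuous_form X Y).tendsto hg).sub (ha'.mul ((hX.inner hY).const_mul 4))).sub
    (hb'.mul (((hX.inner hg).const_mul 2).mul ((hY.inner hg).const_mul 2)))

variable {Θ : ∀ (Ω : Type u) [MeasurableSpace Ω], TwoTensorField Ω}
variable {I : Type u} [MeasurableSpace I] [Fintype I] [DiscreteMeasurableSpace I]

/-- Mass, `fisher` and `tauOne` of functions of `f` are integrals against the law of `f`, so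
subtracting them preserves the invariance. -/
theorem IsCongruentFamily.defect_comp (hΘ : IsCongruentFamily Θ) (a b : ℝ → ℝ)
    (μ : FiniteMeasure Ω) {f : Ω → I} (hf : Measurable f) (x y : I → ℝ) :
    defect (Θ Ω) a b μ (vec μ (x ∘ f)) (vec μ (y ∘ f)) =
      defect (Θ I) a b (μ.map f) (vec _ x) (vec _ y) := by
  have hint : ∀ z : I → ℝ, ∫ i, z i ∂(μ.map f : Measure I) = ∫ ω, z (f ω) ∂(μ : Measure Ω) := by
    intro z
    rw [FiniteMeasure.toMeasure_map]
    exact integral_map hf.aemeasurable (measurable_of_finite z).aestronglyMeasurable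
  have hmass : (μ.map f).mass = μ.mass := by
    rw [FiniteMeasure.mass, FiniteMeasure.map_apply _ hf .univ]
    rfl
  rw [defect_apply, defect_apply, hΘ.form_comp μ hf, hmass,
    fisher_vec (memLp_finite hf x) (memLp_finite hf y), tauOne_vec (memLp_finite hf x),
    tauOne_vec (memLp_finite hf y), fisher_vec (memLp_fintype _ x) (memLp_fintype _ y),
    tauOne_vec (memLp_fintype _ x), tauOne_vec (memLp_fintype _ y),
    hint x, hint y, hint fun i => x i * y i]
  rfl

end Defect

/-! ### Vanishing of the defect. -/

section Campbell

variable {Θ : ∀ (Ω : Type u) [MeasurableSpace Ω], TwoTensorField Ω} {a b : ℝ → ℝ}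
  {J : Type u} [MeasurableSpace J] [Fintype J] [DiscreteMeasurableSpace J]

/-- The first transposition moves `i'` to `i`; the second moves the image of `j'` to `j` and fixes
`i`. -/
theorem exists_perm_pair {α : Type*} [DecidableEq α] {i j i' j' : α} (h : i ≠ j) (h' : i' ≠ j') :
    ∃ σ : Equiv.Perm α, σ i' = i ∧ σ j' = j := by
  refine ⟨Equiv.swap (Equiv.swap i' i j') j * Equiv.swap i' i, ?_, ?_⟩
  · rw [Equiv.Perm.mul_apply, Equiv.swap_apply_left, Equiv.swap_apply_of_ne_of_ne _ h]
    intro h1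
    apply h'
    apply (Equiv.swap i' i).injective
    exact (Equiv.swap_apply_left ..).trans h1
  · rw [Equiv.Perm.mul_apply, Equiv.swap_apply_left]

theorem map_weighted_apply {I : Type u} [MeasurableSpace I] [Fintype I]
    [DiscreteMeasurableSpace I] [DecidableEq I] (w : J → ℝ≥0) (f : J → I) :
    (weighted w).map f = weighted fun i => ∑ j, if f j = i then w j else 0 := by
  classical
  refine eq_weighted_of_singleton fun i => ?_
  rw [FiniteMeasure.toMeasure_map, Measure.map_apply (measurable_of_finite f) (.of_discrete),
    weighted_apply]
  push_cast
  refine Finset.sum_congr rfl fun j _ => ?_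
  split_ifs with h1 h2 h2
  · rfl
  · exact absurd h1 h2
  · exact absurd h2 h1
  · rfl

theorem IsCongruentFamily.defect_map_weighted (hΘ : IsCongruentFamily Θ) (a b : ℝ → ℝ)
    {I : Type u} [MeasurableSpace I] [Fintype I] [DiscreteMeasurableSpace I] [DecidableEq I]
    (w : J → ℝ≥0) (f : J → I) {w' : I → ℝ≥0} (hw : ∀ i, w' i = ∑ j, if f j = i then w j else 0)
    (x y : I → ℝ) :
    defect (Θ I) a b (weighted w') (vec _ x) (vec _ y) =
      defect (Θ J) a b (weighted w) (vec _ (x ∘ f)) (vec _ (y ∘ f)) := by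
  rw [hΘ.defect_comp a b _ (measurable_of_finite f), map_weighted_apply, ← funext hw]

theorem IsCongruentFamily.defect_perm (hΘ : IsCongruentFamily Θ) (a b : ℝ → ℝ) (c : ℝ≥0)
    [DecidableEq J] (σ : Equiv.Perm J) (x y : J → ℝ) :
    defect (Θ J) a b (weighted fun _ => c) (vec _ (x ∘ σ)) (vec _ (y ∘ σ)) =
      defect (Θ J) a b (weighted fun _ => c) (vec _ x) (vec _ y) := by
  refine (hΘ.defect_map_weighted a b _ σ (fun i => ?_) x y).symm
  simp [← Equiv.eq_symm_apply]

theorem defect_eq_sum (Ψ : TwoTensorField J) (a b : ℝ → ℝ) (μ : FiniteMeasure J)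
    [DecidableEq J] (x y : J → ℝ) :
    defect Ψ a b μ (vec μ x) (vec μ y) = ∑ i, ∑ j, x i * y j *
      defect Ψ a b μ (vec μ (Pi.single i 1)) (vec μ (Pi.single j 1)) := by
  have h : ∀ z : J → ℝ, vec μ z = ∑ i, z i • vec μ (Pi.single i 1) := by
    intro z
    have h1 := vec_sum (μ := μ) Finset.univ
        (f := fun j i => z j * (Pi.single j 1 : J → ℝ) i) fun j _ => memLp_fintype _ _
    have h' : (fun i => ∑ j, z j * (Pi.single j 1 : J → ℝ) i) = z := by
      ext i
      simp [Pi.single_apply]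
    rw [h'] at h1
    rw [h1]
    exact Finset.sum_congr rfl fun j _ => vec_smul _ (memLp_fintype _ _)
  rw [h x, h y]
  simp only [map_sum, map_smul, LinearMap.sum_apply, LinearMap.smul_apply, smul_eq_mul,
    Finset.mul_sum]
  rw [Finset.sum_comm]
  exact Finset.sum_congr rfl fun i _ => Finset.sum_congr rfl fun j _ => by ring

/-- The two-point space. -/
abbrev TwoPoint : Type u := ULift.{u} Bool

/-- The indicator function of a point of the two-point space. -/
noncomputable def pt (t : Bool) : TwoPoint.{u} → ℝ := Pi.single (ULift.up t) 1

/-- `a` and `b` are the right coefficients for the uniform measures on the two-point space. -/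
def NormalizedOnTwoPoint (Θ : ∀ (Ω : Type u) [MeasurableSpace Ω], TwoTensorField Ω)
    (a b : ℝ → ℝ) : Prop :=
  ∀ c : ℝ≥0, ∀ t : Bool,
    defect (Θ TwoPoint) a b (weighted fun _ => c) (vec _ (pt false)) (vec _ (pt t)) = 0

theorem IsCongruentFamily.defect_uniform_prod (hΘ : IsCongruentFamily Θ)
    (h2 : NormalizedOnTwoPoint Θ a b) (c : ℝ≥0) (x y : J × Bool → ℝ) :
    defect (Θ (J × Bool)) a b (weighted fun _ => c) (vec _ x) (vec _ y) = 0 := by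
  classical
  set D : J × Bool → J × Bool → ℝ := fun p q => defect (Θ (J × Bool)) a b (weighted fun _ => c)
    (vec _ (Pi.single p 1)) (vec _ (Pi.single q 1)) with hD
  have hperm : ∀ (σ : Equiv.Perm (J × Bool)) p q, D (σ p) (σ q) = D p q := by
    intro σ p q
    have hs : ∀ r, (Pi.single (σ r) 1 : J × Bool → ℝ) ∘ σ = Pi.single r 1 := by
      intro r
      ext s
      simp [Pi.single_apply]
    simp only [hD]
    rw [← hΘ.defect_perm a b c σ, hs, hs]
  suffices hzero : ∀ p q, D p q = 0 by
    rw [defect_eq_sum]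
    exact Finset.sum_eq_zero fun p _ => Finset.sum_eq_zero fun q _ => by
      rw [show defect _ a b _ _ _ = 0 from hzero p q, mul_zero]
  intro p q
  have hcard : (Fintype.card J : ℝ) ≠ 0 := by
    have : Nonempty J := ⟨p.1⟩
    exact_mod_cast Fintype.card_ne_zero
  -- Projection to the second factor yields a uniform two-point measure with weights `Fintype.card J
  -- * c`, where the defect vanishes by normalization.
  have hpull : ∀ t, ∑ j, ∑ j', D (j, false) (j', t) = 0 := by
    intro t
    have h := hΘ.defect_map_weighted a b (fun _ : J × Bool => c)
      (fun p => (ULift.up p.2 : TwoPoint.{u})) (w' := fun _ => Fintype.card J * c)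
      (fun i => by
        simp only [Fintype.sum_prod_type, ULift.ext_iff]
        simp) (pt false) (pt t)
    rw [h2, defect_eq_sum] at h
    rw [h]
    simp [pt, Fintype.sum_prod_type, Pi.single_apply, ULift.ext_iff, hD]
  have hoff : ∀ p q, p ≠ q → D p q = 0 := by
    -- For `t = true` every entry of the sum is off-diagonal, and all off-diagonal entries are
    -- equal.
    have h0 : D (p.1, false) (p.1, true) = 0 := by
      have h := hpull true
      have hc : ∀ j j', D (j, false) (j', true) = D (p.1, false) (p.1, true) := by
        intro j j'
        obtain ⟨σ, h1, h2⟩ := exists_perm_pair (i := (j, false)) (j := (j', true))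
          (i' := (p.1, false)) (j' := (p.1, true)) (by simp) (by simp)
        rw [← h1, ← h2, hperm]
      simp only [hc, Finset.sum_const, Finset.card_univ, nsmul_eq_mul] at h
      simpa [hcard] using h
    intro r s hrs
    obtain ⟨σ, h1, h2⟩ := exists_perm_pair hrs
      (show (p.1, false) ≠ (p.1, true) by simp)
    rw [← h1, ← h2, hperm, h0]
  rcases ne_or_eq p q with hpq | rfl
  · exact hoff p q hpq
  have h := hpull false
  -- For `t = false` only the equal diagonal entries survive.
  have hc : ∀ j j', D (j, false) (j', false) = if j = j' then D p p else 0 := by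
    intro j j'
    split_ifs with hj
    · subst hj
      rw [← hperm (Equiv.swap p (j, false)) p p, Equiv.swap_apply_left]
    · exact hoff _ _ (by simpa using hj)
  simp only [hc, Finset.sum_ite_eq, Finset.mem_univ, if_true, Finset.sum_const, Finset.card_univ,
    nsmul_eq_mul] at h
  simpa [hcard] using h

theorem IsCongruentFamily.defect_weighted_rat (hΘ : IsCongruentFamily Θ)
    (h2 : NormalizedOnTwoPoint Θ a b) (k : J → ℕ) (c : ℝ≥0) (x y : J → ℝ) :
    defect (Θ J) a b (weighted fun j => k j * c) (vec _ x) (vec _ y) = 0 := by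
  classical
  let : MeasurableSpace (Σ j, Fin (k j)) := ⊤
  have : DiscreteMeasurableSpace (Σ j, Fin (k j)) := ⟨fun _ => trivial⟩
  -- The atom `j` is split into `2 * k j` atoms of mass `c / 2`; the factor `Bool` is what the
  -- uniform case requires.
  rw [hΘ.defect_map_weighted a b (fun _ : (Σ j, Fin (k j)) × Bool => c / 2) (fun p => p.1.1)]
  · exact hΘ.defect_uniform_prod h2 _ _ _
  · intro i
    have h : ∀ j, ∑ _ : Fin (k j), ∑ _ : Bool, (if j = i then c / 2 else 0) =
        if j = i then k j * c else 0 := by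
      intro j
      split_ifs
      · rw [Fintype.sum_bool, add_halves]
        simp
      · simp
    simp only [Fintype.sum_prod_type, Fintype.sum_sigma]
    refine Eq.trans ?_ (Finset.sum_congr rfl fun j _ => (h j).symm)
    simp

theorem IsCongruentFamily.defect_weighted (hΘ : IsCongruentFamily Θ)
    (ha : ContinuousOn a (Ioi 0)) (hb : ContinuousOn b (Ioi 0))
    (h2 : NormalizedOnTwoPoint Θ a b) (w : J → ℝ≥0) (x y : J → ℝ) :
    defect (Θ J) a b (weighted w) (vec _ x) (vec _ y) = 0 := by
  by_cases hw : weighted w = 0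
  · exact defect_zero _ _ _ hw _ _
  have hlim : Tendsto (fun (n : ℕ) (j : J) => (⌊w j * n⌋₊ : ℝ≥0) * (n : ℝ≥0)⁻¹) atTop (𝓝 w) := by
    rw [tendsto_pi_nhds]
    intro j
    rw [← NNReal.tendsto_coe]
    have := (tendsto_nat_floor_mul_div_atTop (R := ℝ) (w j).coe_nonneg).comp
      tendsto_natCast_atTop_atTop
    refine this.congr fun n => ?_
    simp only [Function.comp_apply, div_eq_mul_inv]
    push_cast
    congr 3
  have h := tendsto_defect (Θ J) ha hb (finiteField x) (finiteField y) hw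
    ((continuous_sqrtMeasure_weighted.tendsto w).comp hlim)
  refine tendsto_nhds_unique h ?_
  refine tendsto_const_nhds.congr fun n => ?_
  exact (hΘ.defect_weighted_rat h2 _ _ x y).symm

theorem IsCongruentFamily.defect_simple (hΘ : IsCongruentFamily Θ)
    (ha : ContinuousOn a (Ioi 0)) (hb : ContinuousOn b (Ioi 0))
    (h2 : NormalizedOnTwoPoint Θ a b) {Ω : Type u} [MeasurableSpace Ω] (μ : FiniteMeasure Ω)
    {V W : tangent μ} (hV : V ∈ simpleTangent μ) (hW : W ∈ simpleTangent μ) :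
    defect (Θ Ω) a b μ V W = 0 := by
  obtain ⟨f, rfl⟩ := hV
  obtain ⟨g, rfl⟩ := hW
  -- The pair of values is a single finite-valued statistic through which both simple functions
  -- factor.
  let F : Ω → ULift.{u} (f.range × g.range) := fun ω =>
    ⟨⟨f ω, SimpleFunc.mem_range_self f ω⟩, ⟨g ω, SimpleFunc.mem_range_self g ω⟩⟩
  have hF : Measurable F :=
    measurable_up.comp ((f.measurable.subtype_mk).prodMk (g.measurable.subtype_mk))
  have h := hΘ.defect_comp a b μ hF (fun i => (i.down.1 : ℝ)) (fun i => (i.down.2 : ℝ))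
  rw [eq_weighted (μ.map F)] at h
  exact h.trans (hΘ.defect_weighted ha hb h2 _ _ _)

theorem sqrtMeasure_smul {Ω : Type u} [MeasurableSpace Ω] (t : ℝ≥0) (μ : FiniteMeasure Ω) :
    sqrtMeasure (t • μ) = √(t : ℝ) • sqrtMeasure μ := by
  rw [sqrtMeasure_eq_vec_of_withDensity (κ := μ) (g := fun _ => √(t : ℝ)) measurable_const
    (fun _ => Real.sqrt_nonneg _), sqrtMeasure_eq_vec, ← Submodule.coe_smul,
    ← vec_smul _ (memLp_const 1)]
  · simp
  · rw [FiniteMeasure.toMeasure_smul, withDensity_const, Real.sq_sqrt t.coe_nonneg,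
      ENNReal.ofReal_coe_nnreal]
    rfl

theorem IsCongruentFamily.defect_eq_zero (hΘ : IsCongruentFamily Θ)
    (ha : ContinuousOn a (Ioi 0)) (hb : ContinuousOn b (Ioi 0))
    (h2 : NormalizedOnTwoPoint Θ a b) {Ω : Type u} [MeasurableSpace Ω] (μ : FiniteMeasure Ω)
    (V W : tangent μ) : defect (Θ Ω) a b μ V W = 0 := by
  by_cases hμ : μ = 0
  · exact defect_zero _ _ _ hμ _ _
  obtain ⟨X, rfl, hX⟩ := exists_vectorField μ V
  obtain ⟨Y, rfl, hY⟩ := exists_vectorField μ W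
  -- Rescaling approaches `μ` without reaching it: the mass is nonzero and `t n ≠ 1`.
  set t : ℕ → ℝ≥0 := fun n => 1 + 1 / ((n : ℝ≥0) + 1) with ht
  have hlim : Tendsto (fun n => sqrtMeasure (t n • μ)) atTop (𝓝 (sqrtMeasure μ)) := by
    simp only [sqrtMeasure_smul]
    have h1 : Tendsto (fun n => √(t n : ℝ)) atTop (𝓝 √(1 + 0)) := by
      refine (Real.continuous_sqrt.tendsto _).comp ?_
      simp only [ht]
      push_cast
      exact tendsto_const_nhds.add tendsto_one_div_add_atTop_nhds_zero_nat
    have h3 := h1.smul_const (sqrtMeasure μ)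
    simpa using h3
  refine tendsto_nhds_unique (tendsto_defect (Θ Ω) ha hb X Y hμ hlim) ?_
  refine tendsto_const_nhds.congr fun n => ?_
  have hne : t n • μ ≠ μ := by
    intro h
    have h3 := congrArg FiniteMeasure.mass h
    have h4 : μ.mass ≠ 0 := (FiniteMeasure.mass_nonzero_iff μ).2 hμ
    have h5 : (t n • μ).mass = t n * μ.mass := by
      simp [FiniteMeasure.mass]
    rw [h5] at h3
    have h6 : t n = 1 := mul_right_cancel₀ h4 (h3.trans (one_mul _).symm)
    simp [ht] at h6
  exact (hΘ.defect_simple ha hb h2 _ (hX _ hne) (hY _ hne)).symm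

/-- The value of the family on indicator functions for the uniform measure of mass `r` on the
two-point space. -/
noncomputable def twoPointValue (Θ : ∀ (Ω : Type u) [MeasurableSpace Ω], TwoTensorField Ω)
    (t : Bool) (r : ℝ) : ℝ :=
  (Θ TwoPoint).form (weighted fun _ => (r / 2).toNNReal) (vec _ (pt false)) (vec _ (pt t))

theorem continuous_twoPointValue (Θ : ∀ (Ω : Type u) [MeasurableSpace Ω], TwoTensorField Ω)
    (t : Bool) : Continuous (twoPointValue Θ t) := by
  rw [continuous_iff_continuousAt]
  intro r
  refine ((Θ TwoPoint).continuous_form (finiteField (pt false)) (finiteField (pt t))).tendsto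
    (g := fun r : ℝ => weighted fun _ => (r / 2).toNNReal) ?_
  have h : Continuous fun (r : ℝ) (_ : TwoPoint.{u}) => (r / 2).toNNReal := by fun_prop
  exact (continuous_sqrtMeasure_weighted.comp h).tendsto r

theorem exists_normalized (Θ : ∀ (Ω : Type u) [MeasurableSpace Ω], TwoTensorField Ω) :
    ∃ a b : ℝ → ℝ, ContinuousOn a (Ioi 0) ∧ ContinuousOn b (Ioi 0) ∧
      NormalizedOnTwoPoint Θ a b := by
  -- For the uniform measure of mass `r`, `fisher` is `2 * r` on equal indicators and `0` on
  -- distinct ones, and `tauOne` is `r`. The values to match are `2 * r * a + r ^ 2 * b` and `r ^ 2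
  -- * b`.
  refine ⟨fun r => (twoPointValue Θ false r - twoPointValue Θ true r) / (2 * r),
    fun r => twoPointValue Θ true r / r ^ 2, ?_, ?_, ?_⟩
  · refine ((continuous_twoPointValue Θ false).sub
      (continuous_twoPointValue Θ true)).continuousOn.div (by fun_prop) fun r hr => ?_
    exact mul_ne_zero two_ne_zero (ne_of_gt hr)
  · refine (continuous_twoPointValue Θ true).continuousOn.div (by fun_prop) fun r hr => ?_
    exact pow_ne_zero 2 (ne_of_gt hr)
  · intro c t
    have hmass : (weighted fun _ : TwoPoint.{u} => c).mass = 2 * c := by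
      rw [mass_weighted]
      simp
    rcases eq_or_ne c 0 with rfl | hc
    · refine defect_zero _ _ _ ?_ _ _
      rw [← FiniteMeasure.mass_zero_iff, hmass, mul_zero]
    have hc' : (c : ℝ) ≠ 0 := by exact_mod_cast hc
    have hv : ∀ t, (Θ TwoPoint).form (weighted fun _ => c) (vec _ (pt false)) (vec _ (pt t)) =
        twoPointValue Θ t (2 * c) := by
      intro t
      have h : (2 * (c : ℝ) / 2).toNNReal = c := by
        rw [mul_div_cancel_left₀ _ two_ne_zero, Real.toNNReal_coe]
      rw [twoPointValue, h]
    have hsum : ∀ z : TwoPoint.{u} → ℝ, ∑ i, z i = z ⟨true⟩ + z ⟨false⟩ := by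
      intro z
      rw [← Equiv.sum_comp Equiv.ulift.symm z, Fintype.sum_bool]
      rfl
    rw [defect_apply, hv, hmass, fisher_vec (memLp_fintype _ _) (memLp_fintype _ _),
      tauOne_vec (memLp_fintype _ _), tauOne_vec (memLp_fintype _ _), integral_weighted,
      integral_weighted, integral_weighted, hsum, hsum, hsum]
    cases t
    · simp [pt]
      field_simp
      ring
    · simp [pt]
      field_simp
      ring

/-- Every congruent family of `2`-tensors is a combination of the Fisher metric and `τ¹ ⊗ τ¹` with
coefficients depending continuously on the total mass. -/
theorem IsCongruentFamily.exists_form_eq (hΘ : IsCongruentFamily Θ) :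
    ∃ a b : ℝ → ℝ, ContinuousOn a (Ioi 0) ∧ ContinuousOn b (Ioi 0) ∧
      ∀ (Ω : Type u) [MeasurableSpace Ω] (μ : FiniteMeasure Ω) (V₁ V₂ : tangent μ),
        (Θ Ω).form μ V₁ V₂ = a μ.mass * fisher μ V₁ V₂ +
          b μ.mass * (tauOne μ V₁ * tauOne μ V₂) := by
  obtain ⟨a, b, ha, hb, h2⟩ := exists_normalized Θ
  refine ⟨a, b, ha, hb, fun Ω _ μ V₁ V₂ => ?_⟩
  have h := hΘ.defect_eq_zero ha hb h2 μ V₁ V₂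
  rw [defect_apply] at h
  linarith

end Campbell

/-! ### Differentiating curves of measures and of their roots. -/

section Derivative

variable {Ω : Type u} [MeasurableSpace Ω]

theorem inner_vec_nonneg {μ ν : FiniteMeasure Ω} {φ ψ : Ω → ℝ} (hφ : MemLp φ 2 (μ : Measure Ω))
    (hψ : MemLp ψ 2 (ν : Measure Ω)) (hφ0 : ∀ ω, 0 ≤ φ ω) (hψ0 : ∀ ω, 0 ≤ ψ ω) :
    0 ≤ ⟪(vec μ φ : HalfDensity Ω), (vec ν ψ : HalfDensity Ω)⟫ := by
  obtain ⟨κ, h1, h2⟩ := exists_ac_ac μ ν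
  rw [coe_vec_of_ac h1 hφ, coe_vec_of_ac h2 hψ,
    inner_coe_vec (memLp_mul_rootDeriv' h1 hφ) (memLp_mul_rootDeriv' h2 hψ)]
  exact integral_nonneg fun ω => mul_nonneg (mul_nonneg (hφ0 ω) (Real.sqrt_nonneg _))
    (mul_nonneg (hψ0 ω) (Real.sqrt_nonneg _))

theorem inner_sqrtMeasure_nonneg (μ : FiniteMeasure Ω) {ν : FiniteMeasure Ω} {ψ : Ω → ℝ}
    (hψ : MemLp ψ 2 (ν : Measure Ω)) (hψ0 : ∀ ω, 0 ≤ ψ ω) :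
    0 ≤ ⟪sqrtMeasure μ, (vec ν ψ : HalfDensity Ω)⟫ := by
  rw [sqrtMeasure_eq_vec]
  exact inner_vec_nonneg (memLp_const 1) hψ (fun _ => zero_le_one) hψ0

variable {q : ℝ → FiniteMeasure Ω} {D : HalfDensity Ω}

/-- The pairing with a nonnegative half-density is nonnegative for all times and zero at time 0, so
it has a minimum there. -/
theorem inner_deriv_eq_zero (hq : HasDerivAt (fun t => sqrtMeasure (q t)) D 0)
    {κ : FiniteMeasure Ω} {ψ : Ω → ℝ} (hψ : MemLp ψ 2 (κ : Measure Ω)) (hψ0 : ∀ ω, 0 ≤ ψ ω)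
    (h0 : ⟪sqrtMeasure (q 0), (vec κ ψ : HalfDensity Ω)⟫ = 0) :
    ⟪D, (vec κ ψ : HalfDensity Ω)⟫ = 0 := by
  have hd := hq.inner ℝ (hasDerivAt_const (0 : ℝ) (vec κ ψ : HalfDensity Ω))
  rw [inner_zero_right, zero_add] at hd
  refine IsLocalMin.hasDerivAt_eq_zero (.of_forall fun t => ?_) hd
  rw [h0]
  exact inner_sqrtMeasure_nonneg _ hψ hψ0

/-- The derivative of a curve in `ℳ^{1/2}(Ω)` lies in the tangent cone. -/
theorem exists_vec_of_hasDerivAt {μ : FiniteMeasure Ω} (hμ : q 0 = μ)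
    (hq : HasDerivAt (fun t => sqrtMeasure (q t)) D 0) :
    ∃ φ : Ω → ℝ, MemLp φ 2 (μ : Measure Ω) ∧ D = vec μ φ := by
  subst hμ
  obtain ⟨κ, d, hac, hdm, hd, rfl⟩ := HalfDensity.exists_vec_of_ac (q 0) D
  set r := rootDeriv (q 0 : Measure Ω) (κ : Measure Ω) with hr
  have hrm : Measurable r := measurable_rootDeriv _ _
  set N : Set Ω := {ω | r ω = 0} with hNdef
  have hN : MeasurableSet N := measurableSet_eq_fun hrm measurable_const
  set e := N.indicator d with he
  have heL : MemLp e 2 (κ : Measure Ω) := hd.indicator hN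
  have hre : ∀ ω, r ω = 0 ∨ e ω = 0 := fun ω => by
    by_cases h : ω ∈ N
    · exact Or.inl h
    · exact Or.inr (indicator_of_notMem h d)
  -- The positive and negative parts of `d` on `{r = 0}` are orthogonal to the root of `q 0`.
  -- Together they give `∫ e ^ 2 = 0`: `d` vanishes where `r` does, and `d / r` is the density
  -- sought.
  have hpos : ⟪(vec κ d : HalfDensity Ω), (vec κ fun ω => max (e ω) 0 : HalfDensity Ω)⟫ = 0 := by
    refine inner_deriv_eq_zero hq heL.pos_part (fun ω => le_max_right _ _) ?_
    rw [sqrtMeasure_eq_vec_of_ac hac, inner_coe_vec (memLp_rootDeriv hac) heL.pos_part]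
    refine integral_eq_zero_of_ae (.of_forall fun ω => ?_)
    rcases hre ω with h | h <;> simp [← hr, h]
  have hneg : ⟪(vec κ d : HalfDensity Ω), (vec κ fun ω => max (-e ω) 0 : HalfDensity Ω)⟫ = 0 := by
    refine inner_deriv_eq_zero hq heL.neg_part (fun ω => le_max_right _ _) ?_
    rw [sqrtMeasure_eq_vec_of_ac hac, inner_coe_vec (memLp_rootDeriv hac) heL.neg_part]
    refine integral_eq_zero_of_ae (.of_forall fun ω => ?_)
    rcases hre ω with h | h <;> simp [← hr, h]
  have hsplit : vec κ (fun ω => max (e ω) 0) = vec κ (fun ω => max (-e ω) 0) + vec κ e := by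
    rw [← vec_add heL.neg_part heL]
    congr 1
    ext ω
    rcases le_total (e ω) 0 with h | h
    · rw [max_eq_right h, max_eq_left (by linarith)]; ring
    · rw [max_eq_left h, max_eq_right (by linarith)]; ring
  have hzero : ∫ ω, d ω * e ω ∂(κ : Measure Ω) = 0 := by
    rw [← inner_coe_vec hd heL]
    rw [hsplit, Submodule.coe_add, inner_add_right, hneg, zero_add] at hpos
    exact hpos
  have hde : ∀ ω, d ω * e ω = e ω ^ 2 := fun ω => by
    by_cases h : ω ∈ N
    · rw [he, indicator_of_mem h, sq]
    · rw [he, indicator_of_notMem h]; ring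
  simp only [hde] at hzero
  have hae := (integral_eq_zero_iff_of_nonneg (fun ω => sq_nonneg (e ω)) heL.integrable_sq).1 hzero
  have hdr : (fun ω => d ω / r ω * r ω) =ᵐ[(κ : Measure Ω)] d := by
    filter_upwards [hae] with ω hω
    have h0 : e ω = 0 := by simpa using hω
    by_cases h : ω ∈ N
    · have h1 : r ω = 0 := h
      rw [he, indicator_of_mem h] at h0
      rw [h1, h0, mul_zero]
    · exact div_mul_cancel₀ _ h
  have hm : Measurable fun ω => d ω / r ω := hdm.div hrm
  have hφ : MemLp (fun ω => d ω / r ω) 2 (q 0 : Measure Ω) := by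
    refine ⟨hm.aestronglyMeasurable, ?_⟩
    rw [← eLpNorm_mul_rootDeriv hac hm.stronglyMeasurable, eLpNorm_congr_ae hdr]
    exact hd.eLpNorm_lt_top
  refine ⟨_, hφ, ?_⟩
  rw [coe_vec_of_ac hac hφ, vec_congr hdr]

theorem memLp_indicator_one (μ : FiniteMeasure Ω) {A : Set Ω} (hA : MeasurableSet A) :
    MemLp (A.indicator fun _ => (1 : ℝ)) 2 (μ : Measure Ω) :=
  (memLp_const 1).indicator hA

/-- Multiplication by an indicator is a self-adjoint projection. -/
theorem inner_sqrtMeasure_indicator (ν μ : FiniteMeasure Ω) {A : Set Ω} (hA : MeasurableSet A) :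
    ⟪sqrtMeasure ν, (vec μ (A.indicator fun _ => 1) : HalfDensity Ω)⟫ =
      ⟪(vec ν (A.indicator fun _ => 1) : HalfDensity Ω),
        (vec μ (A.indicator fun _ => 1) : HalfDensity Ω)⟫ := by
  obtain ⟨κ, h1, h2⟩ := exists_ac_ac ν μ
  have hν := memLp_indicator_one ν hA
  have hμ := memLp_indicator_one μ hA
  rw [sqrtMeasure_eq_vec_of_ac h1, coe_vec_of_ac h1 hν, coe_vec_of_ac h2 hμ,
    inner_coe_vec (memLp_rootDeriv h1) (memLp_mul_rootDeriv' h2 hμ),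
    inner_coe_vec (memLp_mul_rootDeriv' h1 hν) (memLp_mul_rootDeriv' h2 hμ)]
  congr 1
  ext ω
  by_cases h : ω ∈ A <;> simp [h]

theorem norm_vec_indicator_sq (μ : FiniteMeasure Ω) {A : Set Ω} (hA : MeasurableSet A) :
    ‖(vec μ (A.indicator fun _ => 1) : HalfDensity Ω)‖ ^ 2 = (μ : Measure Ω).real A := by
  have hμ := memLp_indicator_one μ hA
  rw [← real_inner_self_eq_norm_sq, inner_coe_vec hμ hμ, ← integral_indicator_one hA]
  congr 1
  ext ω
  by_cases h : ω ∈ A <;> simp [h]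

/-- Evaluation of signed measures at a set, as a continuous linear form. -/
noncomputable def evalCLM (A : Set Ω) : SignedMeasure Ω →L[ℝ] ℝ :=
  LinearMap.mkContinuous
    { toFun := fun σ => σ A
      map_add' := fun _ _ => rfl
      map_smul' := fun _ _ => rfl } 1 fun σ => by
    rw [one_mul, SignedMeasure.norm_def, SignedMeasure.totalVariation_eq_variation]
    have hfin : σ.variation univ ≠ ∞ := by
      rw [← SignedMeasure.totalVariation_eq_variation]
      exact SignedMeasure.totalVariation_univ_ne_top σ
    have h : ‖σ A‖ₑ ≤ σ.variation univ :=
      (σ.enorm_measure_le_variation A).trans (measure_mono (subset_univ A))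
    have h' := ENNReal.toReal_mono hfin h
    rwa [toReal_enorm] at h'

theorem evalCLM_toSignedMeasure (μ : FiniteMeasure Ω) {A : Set Ω} (hA : MeasurableSet A) :
    evalCLM A (μ : Measure Ω).toSignedMeasure = (μ : Measure Ω).real A :=
  Measure.toSignedMeasure_apply_measurable hA

/-- The derivative of `μ` is `2 φ μ` if the derivative of `μ^{1/2}` is `φ μ^{1/2}`. -/
theorem deriv_apply_eq {μ : FiniteMeasure Ω} (hμ : q 0 = μ) {φ : Ω → ℝ} {σ : SignedMeasure Ω}
    (hφ : MemLp φ 2 (μ : Measure Ω))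
    (hq : HasDerivAt (fun t => sqrtMeasure (q t)) (vec μ φ : HalfDensity Ω) 0)
    (hσ : HasDerivAt (fun t => (q t : Measure Ω).toSignedMeasure) σ 0) {A : Set Ω}
    (hA : MeasurableSet A) : σ A = ∫ ω in A, 2 * φ ω ∂(μ : Measure Ω) := by
  subst hμ
  have h1 : HasDerivAt (fun t => (q t : Measure Ω).real A) (σ A) 0 := by
    have h := (evalCLM A).hasFDerivAt.comp_hasDerivAt (0 : ℝ) hσ
    exact h.congr_of_eventuallyEq (.of_forall fun t => (evalCLM_toSignedMeasure _ hA).symm)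
  obtain ⟨v, hv⟩ : ∃ v : HalfDensity Ω, v = vec (q 0) (A.indicator fun _ => 1) := ⟨_, rfl⟩
  have h2 := hq.inner ℝ (hasDerivAt_const (0 : ℝ) v)
  rw [inner_zero_right, zero_add, hv, inner_coe_vec hφ (memLp_indicator_one _ hA), ← hv] at h2
  -- The function differentiated here is the squared distance between the roots restricted to `A`;
  -- it is minimal at time 0, so its derivative `σ A - 2 ∫_A φ` vanishes.
  have h3 := (h1.add_const ((q 0 : Measure Ω).real A)).sub (h2.const_mul 2)
  have hsq : ∀ t, (q t : Measure Ω).real A + (q 0 : Measure Ω).real A -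
      2 * ⟪sqrtMeasure (q t), v⟫ = ‖(vec (q t) (A.indicator fun _ => 1) : HalfDensity Ω) - v‖ ^ 2 :=
    fun t => by
      rw [norm_sub_sq_real, hv, inner_sqrtMeasure_indicator _ _ hA, norm_vec_indicator_sq _ hA,
        norm_vec_indicator_sq _ hA]
      ring
  have h4 := IsLocalMin.hasDerivAt_eq_zero (.of_forall fun t => ?_) h3
  · rw [← integral_indicator hA]
    rw [sub_eq_zero] at h4
    rw [h4, ← integral_const_mul]
    congr 1
    ext ω
    by_cases h : ω ∈ A <;> simp [h]
  · change (q 0 : Measure Ω).real A + (q 0 : Measure Ω).real A - 2 * ⟪sqrtMeasure (q 0), v⟫ ≤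
      (q t : Measure Ω).real A + (q 0 : Measure Ω).real A - 2 * ⟪sqrtMeasure (q t), v⟫
    rw [hsq, hsq, hv, sub_self, norm_zero, zero_pow two_ne_zero]
    positivity

/-- Uniqueness of the Lebesgue decomposition, with zero singular part. -/
theorem rnDeriv_ae_eq {μ : FiniteMeasure Ω} {φ : Ω → ℝ} {σ : SignedMeasure Ω}
    (hφ : Integrable φ (μ : Measure Ω))
    (h : ∀ A, MeasurableSet A → σ A = ∫ ω in A, φ ω ∂(μ : Measure Ω)) :
    σ.rnDeriv (μ : Measure Ω) =ᵐ[(μ : Measure Ω)] φ := by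
  refine (SignedMeasure.eq_rnDeriv 0 φ hφ VectorMeasure.MutuallySingular.zero_left ?_).symm
  rw [zero_add]
  ext A hA
  rw [h A hA, withDensityᵥ_apply hφ hA]

end Derivative

/-! ### Parametrized measure models. -/

section Model

variable {E : Type v} [NormedAddCommGroup E] [NormedSpace ℝ E]
  {M : Type w} [TopologicalSpace M] [ChartedSpace E M]

/-- The curve through `ξ` which is a straight line with direction `V` in the preferred chart. -/
noncomputable def chartCurve (ξ : M) (V : E) (t : ℝ) : M :=
  (extChartAt 𝓘(ℝ, E) ξ).symm (extChartAt 𝓘(ℝ, E) ξ ξ + t • V)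

theorem chartCurve_zero (ξ : M) (V : E) : chartCurve ξ V 0 = ξ := by
  rw [chartCurve, zero_smul, add_zero, extChartAt_to_inv]

/-- Directional derivatives on `M` reduce to curves on the line. The model has no boundary, so the
chart derivative is a full one. -/
theorem hasDerivAt_chartCurve {F : Type*} [NormedAddCommGroup F] [NormedSpace ℝ F] {g : M → F}
    {ξ : M} (hg : MDifferentiableAt 𝓘(ℝ, E) 𝓘(ℝ, F) g ξ) (V : E) {D : F}
    (hD : (mfderiv 𝓘(ℝ, E) 𝓘(ℝ, F) g ξ : E →L[ℝ] F) V = D) :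
    HasDerivAt (fun t => g (chartCurve ξ V t)) D 0 := by
  obtain ⟨L, hL⟩ : ∃ L : E →L[ℝ] F, L = mfderiv 𝓘(ℝ, E) 𝓘(ℝ, F) g ξ := ⟨_, rfl⟩
  have h : HasFDerivWithinAt (g ∘ (extChartAt 𝓘(ℝ, E) ξ).symm) L (range 𝓘(ℝ, E))
      (extChartAt 𝓘(ℝ, E) ξ ξ) := hL ▸ hg.hasMFDerivAt.2
  rw [modelWithCornersSelf_coe, range_id, hasFDerivWithinAt_univ] at h
  have hl : HasDerivAt (fun t : ℝ => extChartAt 𝓘(ℝ, E) ξ ξ + t • V) V 0 := by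
    have := ((hasDerivAt_id (0 : ℝ)).smul_const V).const_add (extChartAt 𝓘(ℝ, E) ξ ξ)
    simpa using this
  rw [← hD, ← hL]
  refine HasFDerivAt.comp_hasDerivAt (0 : ℝ) (l := g ∘ (extChartAt 𝓘(ℝ, E) ξ).symm) ?_ hl
  rw [zero_smul, add_zero]
  exact h

variable {Ω : Type u} [MeasurableSpace Ω] {p : M → FiniteMeasure Ω}

theorem IsTwoIntegrable.exists_density (hp : IsTwoIntegrable (E := E) p) (ξ : M) (V : E) :
    ∃ φ : Ω → ℝ, MemLp φ 2 (p ξ : Measure Ω) ∧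
      dSqrtModel (E := E) p ξ V = (vec (p ξ) φ : HalfDensity Ω) ∧
      ∀ A, MeasurableSet A →
        dModel (E := E) p ξ V A = ∫ ω in A, 2 * φ ω ∂(p ξ : Measure Ω) := by
  have h1 := hasDerivAt_chartCurve ((hp.2.mdifferentiable one_ne_zero) ξ) V
    (D := dSqrtModel (E := E) p ξ V) rfl
  have h2 := hasDerivAt_chartCurve (hp.1 ξ) V (D := dModel (E := E) p ξ V) rfl
  have h0 : p (chartCurve ξ V 0) = p ξ := by rw [chartCurve_zero]
  obtain ⟨φ, hφ, hD⟩ := exists_vec_of_hasDerivAt h0 h1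
  rw [hD] at h1
  exact ⟨φ, hφ, hD, fun A hA => deriv_apply_eq h0 hφ h1 h2 hA⟩

omit [TopologicalSpace M] in
-- Total mass is a continuous linear form of the measure, so it inherits differentiability from `p`.
theorem totalMass_eq (p : M → FiniteMeasure Ω) :
    totalMass p = fun ξ => evalCLM univ (p ξ : Measure Ω).toSignedMeasure := by
  ext ξ
  rw [evalCLM_toSignedMeasure _ .univ]
  rfl

theorem IsParametrizedMeasureModel.mdifferentiableAt_totalMass
    (hp : IsParametrizedMeasureModel (E := E) p) (ξ : M) :
    MDifferentiableAt 𝓘(ℝ, E) 𝓘(ℝ, ℝ) (totalMass p) ξ := by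
  rw [totalMass_eq]
  exact (evalCLM univ).mdifferentiableAt.comp ξ (hp ξ)

theorem IsParametrizedMeasureModel.dMass_eq
    (hp : IsParametrizedMeasureModel (E := E) p) (ξ : M) (V : E) :
    dMass (E := E) p ξ V = dModel (E := E) p ξ V univ := by
  have h1 := hasDerivAt_chartCurve (hp.mdifferentiableAt_totalMass ξ) V
    (D := dMass (E := E) p ξ V) rfl
  have h2 := (evalCLM univ).hasFDerivAt.comp_hasDerivAt (0 : ℝ)
    (hasDerivAt_chartCurve (hp ξ) V (D := dModel (E := E) p ξ V) rfl)
  refine h1.unique (h2.congr_of_eventuallyEq (.of_forall fun t => ?_))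
  exact congrFun (totalMass_eq p) _

end Model

end InfoGeom

theorem mainTheorem4
    (Θ : ∀ (Ω : Type u) [MeasurableSpace Ω], InfoGeom.TwoTensorField Ω)
    (hΘ : InfoGeom.IsCongruentFamily Θ) :
    ∃ a b : ℝ → ℝ, ContinuousOn a (Ioi 0) ∧ ContinuousOn b (Ioi 0) ∧
      (∀ (Ω : Type u) [MeasurableSpace Ω] (μ : FiniteMeasure Ω) (V₁ V₂ : InfoGeom.tangent μ),
        (Θ Ω).form μ V₁ V₂ = a μ.mass * InfoGeom.fisher μ V₁ V₂ +
          b μ.mass * (InfoGeom.tauOne μ V₁ * InfoGeom.tauOne μ V₂)) ∧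
      (∀ (Ω : Type u) [MeasurableSpace Ω]
        (E : Type v) [NormedAddCommGroup E] [NormedSpace ℝ E]
        (M : Type w) [TopologicalSpace M] [ChartedSpace E M] [IsManifold 𝓘(ℝ, E) 1 M]
        (p : M → FiniteMeasure Ω), InfoGeom.IsTwoIntegrable (E := E) p →
        ∀ (ξ : M) (V₁ V₂ : TangentSpace 𝓘(ℝ, E) ξ),
          Integrable (fun ω => InfoGeom.logDeriv p ξ V₁ ω * InfoGeom.logDeriv p ξ V₂ ω)
            (p ξ : Measure Ω) ∧
          MDifferentiableAt 𝓘(ℝ, E) 𝓘(ℝ, ℝ) (InfoGeom.totalMass p) ξ ∧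
          ∃ (h₁ : InfoGeom.dSqrtModel p ξ V₁ ∈ InfoGeom.tangent (p ξ))
            (h₂ : InfoGeom.dSqrtModel p ξ V₂ ∈ InfoGeom.tangent (p ξ)),
            (Θ Ω).form (p ξ) ⟨InfoGeom.dSqrtModel p ξ V₁, h₁⟩
                ⟨InfoGeom.dSqrtModel p ξ V₂, h₂⟩ =
              a (p ξ).mass * ∫ ω, InfoGeom.logDeriv p ξ V₁ ω * InfoGeom.logDeriv p ξ V₂ ω
                ∂(p ξ : Measure Ω) +
              b (p ξ).mass * (InfoGeom.dMass p ξ V₁ * InfoGeom.dMass p ξ V₂)) := by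
  obtain ⟨a, b, ha, hb, hform⟩ := hΘ.exists_form_eq
  refine ⟨a, b, ha, hb, hform, ?_⟩
  intro Ω _ E _ _ M _ _ _ p hp ξ V₁ V₂
  obtain ⟨φ₁, hφ₁, hD₁, hσ₁⟩ := hp.exists_density ξ V₁
  obtain ⟨φ₂, hφ₂, hD₂, hσ₂⟩ := hp.exists_density ξ V₂
  -- Since the logarithmic derivatives are `2 φ₁` and `2 φ₂`, the integral of their product is
  -- `fisher`, and the derivative of the mass is `tauOne`.
  have hl₁ : InfoGeom.logDeriv p ξ V₁ =ᵐ[(p ξ : Measure Ω)] fun ω => 2 * φ₁ ω :=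
    InfoGeom.rnDeriv_ae_eq ((hφ₁.integrable one_le_two).const_mul 2) hσ₁
  have hl₂ : InfoGeom.logDeriv p ξ V₂ =ᵐ[(p ξ : Measure Ω)] fun ω => 2 * φ₂ ω :=
    InfoGeom.rnDeriv_ae_eq ((hφ₂.integrable one_le_two).const_mul 2) hσ₂
  have hmul : (fun ω => InfoGeom.logDeriv p ξ V₁ ω * InfoGeom.logDeriv p ξ V₂ ω)
      =ᵐ[(p ξ : Measure Ω)] fun ω => 4 * (φ₁ ω * φ₂ ω) := by
    filter_upwards [hl₁, hl₂] with ω h1 h2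
    rw [h1, h2]
    ring
  refine ⟨((hφ₁.integrable_mul hφ₂).const_mul 4).congr hmul.symm,
    hp.1.mdifferentiableAt_totalMass ξ, hD₁ ▸ Subtype.coe_prop _, hD₂ ▸ Subtype.coe_prop _, ?_⟩
  have e₁ : ∀ h, (⟨InfoGeom.dSqrtModel p ξ V₁, h⟩ : InfoGeom.tangent (p ξ)) =
      InfoGeom.vec (p ξ) φ₁ := fun _ => Subtype.ext hD₁
  have e₂ : ∀ h, (⟨InfoGeom.dSqrtModel p ξ V₂, h⟩ : InfoGeom.tangent (p ξ)) =
      InfoGeom.vec (p ξ) φ₂ := fun _ => Subtype.ext hD₂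
  have m₁ : InfoGeom.dMass p ξ V₁ = 2 * ∫ ω, φ₁ ω ∂(p ξ : Measure Ω) := by
    refine (hp.1.dMass_eq ξ V₁).trans ((hσ₁ _ .univ).trans ?_)
    rw [Measure.restrict_univ, integral_const_mul]
  have m₂ : InfoGeom.dMass p ξ V₂ = 2 * ∫ ω, φ₂ ω ∂(p ξ : Measure Ω) := by
    refine (hp.1.dMass_eq ξ V₂).trans ((hσ₂ _ .univ).trans ?_)
    rw [Measure.restrict_univ, integral_const_mul]
  rw [e₁, e₂, hform, InfoGeom.fisher_vec hφ₁ hφ₂, InfoGeom.tauOne_vec hφ₁,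
    InfoGeom.tauOne_vec hφ₂, integral_congr_ae hmul, integral_const_mul, m₁, m₂]
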